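/- Let $d\ge 1$, let $f$ be a probability density on $\mathbb{R}^d$ with respect to Lebesgue measure, let $X_1,X_2,\ldots$ be i.i.d. random vectors with density $f$, and let $\rho(x,y)$ be the Euclidean distance. Put $V_d=\pi^{d/2}/\Gamma(d/2+1)$ (the volume of the unit ball), $\gamma=-\int_0^\infty e^{-t}\log t\,dt$ (Euler's constant), and, for $N\ge 2$ and $1\le i\le N$, $\rho_i=\min\{\rho(X_i,X_j): 1\le j\le N,\ j\ne i\}$. The Kozachenko–Leonenko estimator of the differential entropy $H=-\int_{\mathbb{R}^d} f(x)\log f(x)\,dx$ (with $0\log 0=0$) is $$H_N = d\log\big((\rho_1\cdots\rho_N)^{1/N}\big)+\log V_d+\gamma+\log(N-1).$$ Let $G(t)=0$ for $0\le t<1$ and $G(t)=t\log t$ for $t\ge 1$. For $x\in\mathbb{R}^d$ and $r,R>0$ let $$I_f(x,r)=\frac{1}{r^dV_d}\int_{\rho(x,y)\le r} f(y)\,dy,\qquad M_f(x,R)=\sup_{r\in(0,R]} I_f(x,r),\qquad m_f(x,R)=\inf_{r\in(0,R]} I_f(x,r),$$ and, for $\varepsilon,R>0$, define the following functionals with values in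 $[0,\infty]$ (with $0^{-\varepsilon}=\infty$ and the integrals in $x$ taken over $\{f>0\}$): $$K_{f,2}(\varepsilon)=\int_{\mathbb{R}^d}\Big(\int_{\mathbb{R}^d\setminus\{x\}} G\big(\log^2\rho(x,y)\big)f(y)\,dy\Big)^{1+\varepsilon}f(x)\,dx,$$ $$Q_f(\varepsilon,R)=\int_{\mathbb{R}^d} M_f(x,R)^{\varepsilon}f(x)\,dx,\qquad T_f(\varepsilon,R)=\int_{\mathbb{R}^d} m_f(x,R)^{-\varepsilon}f(x)\,dx.$$ **Theorem 2.** Assume that $K_{f,2}(\varepsilon_0)<\infty$, $Q_f(\varepsilon_1,R_1)<\infty$ and $T_f(\varepsilon_2,R_2)<\infty$ for some positive $\varepsilon_0,\varepsilon_1,\varepsilon_2,R_1,R_2$. Then $f\log f$ is integrable, so that $H$ is finite, and the estimators $H_N$ are $L^2$-consistent: $$\mathsf{E}(H_N-H)^2\to 0\qquad (N\to\infty).$$ -/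

import Mathlib

open MeasureTheory ProbabilityTheory Filter Topology
open scoped ENNReal

noncomputable section

namespace KozachenkoLeonenko

/-- `G t = 0` for `t < 1` and `G t = t log t` for `t ≥ 1`. -/
def G (t : ℝ) : ℝ := if t < 1 then 0 else t * Real.log t

/-- The volume `π ^ (d / 2) / Γ (d / 2 + 1)` of the unit ball of `ℝ ^ d`. -/
def unitBallVol (d : ℕ) : ℝ := Real.pi ^ ((d : ℝ) / 2) / Real.Gamma ((d : ℝ) / 2 + 1)

variable {d : ℕ}

/-- The average of the density `f` over the closed ball of radius `r` about `x`. -/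
def ballAvg (f : EuclideanSpace ℝ (Fin d) → ℝ) (x : EuclideanSpace ℝ (Fin d)) (r : ℝ) : ℝ≥0∞ :=
  (∫⁻ y in Metric.closedBall x r, ENNReal.ofReal (f y)) / ENNReal.ofReal (r ^ d * unitBallVol d)

/-- The supremum of the averages of `f` over the balls about `x` of radius `r ∈ (0, R]`. -/
def maxAvg (f : EuclideanSpace ℝ (Fin d) → ℝ) (x : EuclideanSpace ℝ (Fin d)) (R : ℝ) : ℝ≥0∞ :=
  ⨆ r ∈ Set.Ioc 0 R, ballAvg f x r

/-- The infimum of the averages of `f` over the balls about `x` of radius `r ∈ (0, R]`. -/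
def minAvg (f : EuclideanSpace ℝ (Fin d) → ℝ) (x : EuclideanSpace ℝ (Fin d)) (R : ℝ) : ℝ≥0∞ :=
  ⨅ r ∈ Set.Ioc 0 R, ballAvg f x r

/-- `∫ (∫ G (log² |x - y|) f(y) dy) ^ (1 + ε) f(x) dx`, with values in `[0, ∞]`; the point
`y = x`, where the logarithm is not defined, is left out of the inner integral. -/
def K₂ (f : EuclideanSpace ℝ (Fin d) → ℝ) (ε : ℝ) : ℝ≥0∞ :=
  ∫⁻ x, (∫⁻ y in {x}ᶜ, ENNReal.ofReal (G (Real.log (dist x y) ^ 2)) * ENNReal.ofReal (f y))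
    ^ (1 + ε) * ENNReal.ofReal (f x)

/-- `∫ M_f(x, R) ^ ε f(x) dx`, with values in `[0, ∞]`. -/
def Q (f : EuclideanSpace ℝ (Fin d) → ℝ) (ε R : ℝ) : ℝ≥0∞ :=
  ∫⁻ x, maxAvg f x R ^ ε * ENNReal.ofReal (f x)

/-- `∫ m_f(x, R) ^ (-ε) f(x) dx`, with values in `[0, ∞]`; here `0 ^ (-ε) = ∞` for `ε > 0`. -/
def T (f : EuclideanSpace ℝ (Fin d) → ℝ) (ε R : ℝ) : ℝ≥0∞ :=
  ∫⁻ x, minAvg f x R ^ (-ε) * ENNReal.ofReal (f x)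

/-- The differential Shannon entropy of the density `f` (note `0 * Real.log 0 = 0`). -/
def entropy (f : EuclideanSpace ℝ (Fin d) → ℝ) : ℝ := -∫ x, f x * Real.log (f x)

/-- The distance from the `i`-th point of a sample to its nearest neighbour in the sample
(a minimum over a finite set, nonempty as soon as `N ≥ 2`). -/
def nnDist {N : ℕ} (x : Fin N → EuclideanSpace ℝ (Fin d)) (i : Fin N) : ℝ :=
  ⨅ j : {j : Fin N // j ≠ i}, dist (x i) (x j)

/-- The geometric mean of the nearest-neighbour distances of a sample. -/
def meanNNDist {N : ℕ} (x : Fin N → EuclideanSpace ℝ (Fin d)) : ℝ :=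
  (∏ i, nnDist x i) ^ (1 / (N : ℝ))

/-- The Kozachenko–Leonenko estimate of the entropy from a sample of `N` points. -/
def klEstimate {N : ℕ} (x : Fin N → EuclideanSpace ℝ (Fin d)) : ℝ :=
  d * Real.log (meanNNDist x) + Real.log (unitBallVol d) + Real.eulerMascheroniConstant
    + Real.log ((N : ℝ) - 1)

end KozachenkoLeonenko

end

noncomputable section

namespace KozachenkoLeonenko

variable {d : ℕ}

/-! ### Nearest-neighbour distances in an i.i.d. sample -/

/-! With `N = m + 2`, put `W_i = log ((m + 1) V_d ρ_i ^ d)`, which is `logVol d m (nnDist x i)`.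
Almost surely `H_N` is the average of the `W_i` plus `γ`, so the average must converge in `L²` to `H
- γ`.

Limit law. Given `X_i = x`, the event `W_i > s` says that the other `m + 1` points miss a ball of
volume `e^s / (m + 1)` about `x`. By Lebesgue differentiation its mass is about `e^s f(x) / (m +
1)`, so the probability tends to `exp (-e^s f(x))`: in the limit `W_i` is `log (τ / f(X))` with `τ`
standard exponential and independent of `X`, whose mean is `-γ + H` because `E log τ = Γ'(1) = -γ`.
Around two distinct points the balls are eventually disjoint, so two of the `W_i` become
independent. Hence the empirical survival function converges in mean square at every `s`
(`tendsto_sq_empSurvival_sub`). Integrating over `s ∈ (-A, A]` gives the same for the `W_i` clamped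
to `[-A, A]` (`tendsto_sq_mean_clamp_sub`), and the limits tend to `H - γ` as `A → ∞`
(`tendsto_truncMean`).

Truncation error. By convexity and exchangeability one sample point suffices. On `ρ_0 ≤ R` the
functionals `T` and `Q` bound the upper and lower tail of `W_0` by a multiple of `e^{-εs}`
(`measure_lt_abs_logVol_le`), uniformly in large `m`. The event `ρ_0 > R` has probability of order
`m^{-ε}`. There `W_0²` is at most of order `log² m + log² |X_0 - X_1|`, and `K₂` makes the last term
integrable, so this contribution vanishes (`tendsto_lintegral_sq_logVol_far`). -/

lemma lt_nnDist_iff {m : ℕ} (x : Fin (m + 2) → EuclideanSpace ℝ (Fin d)) (i : Fin (m + 2)) (r : ℝ) :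
    r < nnDist x i ↔ ∀ j, r < dist (x i) (x (i.succAbove j)) := by
  obtain ⟨j₀, hj₀⟩ := exists_ne i
  have : Nonempty {j : Fin (m + 2) // j ≠ i} := ⟨⟨j₀, hj₀⟩⟩
  constructor
  · intro h j
    exact h.trans_le (ciInf_le (Set.finite_range _).bddBelow
      (⟨i.succAbove j, Fin.succAbove_ne i j⟩ : {j : Fin (m + 2) // j ≠ i}))
  · intro h
    obtain ⟨⟨j, hj⟩, hj'⟩ :=
      exists_eq_ciInf_of_finite (f := fun j : {j : Fin (m + 2) // j ≠ i} => dist (x i) (x j))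
    obtain ⟨k, rfl⟩ := Fin.exists_succAbove_eq hj
    unfold nnDist
    rw [← hj']
    exact h k

lemma nnDist_le_dist {m : ℕ} (x : Fin m → EuclideanSpace ℝ (Fin d)) {i j : Fin m} (h : j ≠ i) :
    nnDist x i ≤ dist (x i) (x j) :=
  ciInf_le (Set.finite_range _).bddBelow (⟨j, h⟩ : {j : Fin m // j ≠ i})

lemma measurable_nnDist {m : ℕ} (i : Fin m) :
    Measurable fun x : Fin m → EuclideanSpace ℝ (Fin d) => nnDist x i :=
  Measurable.iInf fun j => (measurable_pi_apply i).dist (measurable_pi_apply (j : Fin m))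

lemma measurable_klEstimate {m : ℕ} :
    Measurable fun x : Fin m → EuclideanSpace ℝ (Fin d) => klEstimate x := by
  unfold klEstimate meanNNDist
  have h : Measurable fun x : Fin m → EuclideanSpace ℝ (Fin d) => ∏ i, nnDist x i :=
    Finset.measurable_fun_prod _ fun i _ => measurable_nnDist i
  fun_prop

section Sample

variable (μ : Measure (EuclideanSpace ℝ (Fin d))) [IsProbabilityMeasure μ]

lemma measurable_measure_closedBall (r : ℝ) : Measurable fun x => μ (Metric.closedBall x r) := by
  have : MeasurableSet {p : EuclideanSpace ℝ (Fin d) × EuclideanSpace ℝ (Fin d) |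
      dist p.2 p.1 ≤ r} :=
    measurableSet_le (measurable_snd.dist measurable_fst) measurable_const
  exact measurable_measure_prodMk_left this

/-- The conditional probability, given one sample point, that its nearest neighbour is further
than `r`, is a power of the mass outside the ball of radius `r`. -/
lemma pi_lt_nnDist (m : ℕ) (i : Fin (m + 2)) (r : ℝ) :
    Measure.pi (fun _ : Fin (m + 2) => μ) {x | r < nnDist x i}
      = ∫⁻ x, ENNReal.ofReal ((1 - μ.real (Metric.closedBall x r)) ^ (m + 1)) ∂μ := by
  have hmp := measurePreserving_piFinSuccAbove (fun _ : Fin (m + 2) => μ) i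
  let S : Set (EuclideanSpace ℝ (Fin d) × (Fin (m + 1) → EuclideanSpace ℝ (Fin d))) :=
    {p | ∀ j, r < dist p.1 (p.2 j)}
  have hS : MeasurableSet S := by
    have : S = ⋂ j, {p | r < dist p.1 (p.2 j)} := by ext; simp [S]
    rw [this]
    exact MeasurableSet.iInter fun j => measurableSet_lt measurable_const
      (measurable_fst.dist ((measurable_pi_apply j).comp measurable_snd))
  have hpre : {x : Fin (m + 2) → EuclideanSpace ℝ (Fin d) | r < nnDist x i}
      = (MeasurableEquiv.piFinSuccAbove (fun _ => EuclideanSpace ℝ (Fin d)) i) ⁻¹' S := by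
    ext x
    simp only [Set.mem_ofPred_eq, lt_nnDist_iff, Set.mem_preimage, S]
    rfl
  rw [hpre, hmp.measure_preimage hS.nullMeasurableSet, Measure.prod_apply hS]
  refine lintegral_congr fun x => ?_
  have : Prod.mk x ⁻¹' S = Set.univ.pi fun _ => (Metric.closedBall x r)ᶜ := by
    ext y
    simp [S, dist_comm]
  rw [this, Measure.pi_pi, Finset.prod_const, Finset.card_univ, Fintype.card_fin,
    ← probReal_compl_eq_one_sub Metric.isClosed_closedBall.measurableSet,
    ENNReal.ofReal_pow measureReal_nonneg, ofReal_measureReal]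

/-- Fubini after splitting off the points `i` and `j`: they must avoid each other, whence the
indicator, and the other `m` points must avoid both balls. The right-hand side is free of `i` and
`j`, so all pairs have the same joint probability. -/
lemma pi_lt_nnDist_pair (m : ℕ) {i j : Fin (m + 2)} (hij : j ≠ i) (r : ℝ) :
    Measure.pi (fun _ : Fin (m + 2) => μ) {x | r < nnDist x i ∧ r < nnDist x j}
      = ∫⁻ x, ∫⁻ y, {p : EuclideanSpace ℝ (Fin d) × EuclideanSpace ℝ (Fin d) |
          r < dist p.1 p.2}.indicator 1 (x, y)
        * μ (Metric.closedBall x r ∪ Metric.closedBall y r)ᶜ ^ m ∂μ ∂μ := by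
  obtain ⟨k, rfl⟩ := Fin.exists_succAbove_eq hij
  have hmp := measurePreserving_piFinSuccAbove (fun _ : Fin (m + 2) => μ) i
  have hmp' := measurePreserving_piFinSuccAbove (fun _ : Fin (m + 1) => μ) k
  let S : Set (EuclideanSpace ℝ (Fin d) × (EuclideanSpace ℝ (Fin d) ×
      (Fin m → EuclideanSpace ℝ (Fin d)))) :=
    {p | r < dist p.1 p.2.1 ∧ ∀ l, r < dist p.1 (p.2.2 l) ∧ r < dist p.2.1 (p.2.2 l)}
  have hS : MeasurableSet S := by
    have : S = {p | r < dist p.1 p.2.1} ∩ ⋂ l, ({p | r < dist p.1 (p.2.2 l)} ∩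
        {p | r < dist p.2.1 (p.2.2 l)}) := by ext; simp [S]
    rw [this]
    refine (measurableSet_lt measurable_const (by fun_prop)).inter
      (MeasurableSet.iInter fun l => (measurableSet_lt measurable_const (by fun_prop)).inter
        (measurableSet_lt measurable_const (by fun_prop)))
  have hcomp := ((MeasurePreserving.id μ).prod hmp').comp hmp
  have hpre : {x : Fin (m + 2) → EuclideanSpace ℝ (Fin d) |
        r < nnDist x i ∧ r < nnDist x (i.succAbove k)}
      = (Prod.map id (MeasurableEquiv.piFinSuccAbove (fun _ => EuclideanSpace ℝ (Fin d)) k) ∘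
        (MeasurableEquiv.piFinSuccAbove (fun _ => EuclideanSpace ℝ (Fin d)) i)) ⁻¹' S := by
    ext x
    have key : ∀ a : Fin (m + 2), (∀ b, b ≠ a → r < dist (x a) (x b)) ↔ r < nnDist x a := by
      intro a
      rw [lt_nnDist_iff]
      refine ⟨fun h j => h _ (Fin.succAbove_ne a j), fun h b hb => ?_⟩
      obtain ⟨c, rfl⟩ := Fin.exists_succAbove_eq hb
      exact h c
    change (r < nnDist x i ∧ r < nnDist x (i.succAbove k)) ↔
      (r < dist (x i) (x (i.succAbove k)) ∧ ∀ l, r < dist (x i) (x (i.succAbove (k.succAbove l))) ∧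
        r < dist (x (i.succAbove k)) (x (i.succAbove (k.succAbove l))))
    rw [← key, ← key]
    constructor
    · rintro ⟨h1, h2⟩
      refine ⟨h1 _ (Fin.succAbove_ne _ _), fun l => ⟨h1 _ (Fin.succAbove_ne _ _), h2 _ ?_⟩⟩
      exact fun h => Fin.succAbove_ne k l (Fin.succAbove_right_injective h)
    · rintro ⟨h1, h2⟩
      have h3 : ∀ b, b ≠ i → b ≠ i.succAbove k → ∃ l, b = i.succAbove (k.succAbove l) := by
        intro b hb hb'
        obtain ⟨c, rfl⟩ := Fin.exists_succAbove_eq hb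
        obtain ⟨l, rfl⟩ := Fin.exists_succAbove_eq (x := c) (y := k) (fun h => hb' (by rw [h]))
        exact ⟨l, rfl⟩
      constructor
      · intro b hb
        by_cases hb' : b = i.succAbove k
        · rw [hb']; exact h1
        · obtain ⟨l, rfl⟩ := h3 b hb hb'
          exact (h2 l).1
      · intro b hb
        by_cases hb' : b = i
        · rw [hb', dist_comm]; exact h1
        · obtain ⟨l, rfl⟩ := h3 b hb' hb
          exact (h2 l).2
  rw [hpre, hcomp.measure_preimage hS.nullMeasurableSet, Measure.prod_apply hS]
  refine lintegral_congr fun x => ?_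
  rw [Measure.prod_apply (measurable_prodMk_left hS)]
  refine lintegral_congr fun y => ?_
  by_cases hxy : r < dist x y
  · have : Prod.mk y ⁻¹' (Prod.mk x ⁻¹' S) =
        Set.univ.pi fun _ => (Metric.closedBall x r ∪ Metric.closedBall y r)ᶜ := by
      ext z
      simp [S, dist_comm, hxy]
    rw [this, Measure.pi_pi, Finset.prod_const, Finset.card_univ, Fintype.card_fin,
      Set.indicator_of_mem (by exact hxy), Pi.one_apply, one_mul]
  · have : Prod.mk y ⁻¹' (Prod.mk x ⁻¹' S) = ∅ := by
      ext z
      simp [S, hxy]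
    rw [this, measure_empty, Set.indicator_of_notMem (by exact hxy), zero_mul]

/-- Exchangeability, read off the survival function: the formula in `pi_lt_nnDist` does not involve
the index, and open half-lines determine a probability measure. -/
lemma map_nnDist_eq (m : ℕ) (i j : Fin (m + 2)) :
    (Measure.pi (fun _ : Fin (m + 2) => μ)).map (fun x => nnDist x i)
      = (Measure.pi (fun _ : Fin (m + 2) => μ)).map (fun x => nnDist x j) := by
  have := Measure.isProbabilityMeasure_map (μ := Measure.pi (fun _ : Fin (m + 2) => μ))
    (measurable_nnDist i).aemeasurable
  have := Measure.isProbabilityMeasure_map (μ := Measure.pi (fun _ : Fin (m + 2) => μ))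
    (measurable_nnDist j).aemeasurable
  refine ext_of_generate_finite (Set.range Set.Ioi) (borel_eq_generateFrom_Ioi ℝ ▸
    BorelSpace.measurable_eq) isPiSystem_Ioi ?_ (by simp)
  rintro _ ⟨r, rfl⟩
  rw [Measure.map_apply (measurable_nnDist i) measurableSet_Ioi,
    Measure.map_apply (measurable_nnDist j) measurableSet_Ioi]
  exact (pi_lt_nnDist μ m i r).trans (pi_lt_nnDist μ m j r).symm

lemma lintegral_comp_nnDist_eq {m : ℕ} (i j : Fin (m + 2)) {φ : ℝ → ℝ≥0∞} (hφ : Measurable φ) :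
    ∫⁻ x, φ (nnDist x i) ∂Measure.pi (fun _ : Fin (m + 2) => μ)
      = ∫⁻ x, φ (nnDist x j) ∂Measure.pi (fun _ : Fin (m + 2) => μ) := by
  rw [← lintegral_map hφ (measurable_nnDist i), map_nnDist_eq μ m i j,
    lintegral_map hφ (measurable_nnDist j)]

end Sample

/-! ### Averages of the density over balls -/

/-- The measure with density `f` with respect to Lebesgue measure. -/
abbrev law (f : EuclideanSpace ℝ (Fin d) → ℝ) : Measure (EuclideanSpace ℝ (Fin d)) :=
  volume.withDensity fun x => ENNReal.ofReal (f x)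

lemma unitBallVol_pos (d : ℕ) : 0 < unitBallVol d :=
  div_pos (Real.rpow_pos_of_pos Real.pi_pos _) (Real.Gamma_pos_of_pos (by positivity))

lemma volume_closedBall_eq (hd : 0 < d) (x : EuclideanSpace ℝ (Fin d)) {r : ℝ} (hr : 0 ≤ r) :
    volume (Metric.closedBall x r) = ENNReal.ofReal (r ^ d * unitBallVol d) := by
  have : Nonempty (Fin d) := ⟨⟨0, hd⟩⟩
  rw [EuclideanSpace.volume_closedBall, Fintype.card_fin, ← ENNReal.ofReal_pow hr,
    ← ENNReal.ofReal_mul (pow_nonneg hr d), unitBallVol, Real.sqrt_eq_rpow, ← Real.rpow_natCast,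
    ← Real.rpow_natCast, ← Real.rpow_mul Real.pi_pos.le]
  congr 4
  ring

lemma ballAvg_eq_div (f : EuclideanSpace ℝ (Fin d) → ℝ) (x : EuclideanSpace ℝ (Fin d)) (r : ℝ) :
    ballAvg f x r
      = law f (Metric.closedBall x r) / ENNReal.ofReal (r ^ d * unitBallVol d) := by
  rw [ballAvg, withDensity_apply _ Metric.isClosed_closedBall.measurableSet]

lemma law_closedBall_eq (f : EuclideanSpace ℝ (Fin d) → ℝ) (x : EuclideanSpace ℝ (Fin d)) {r : ℝ}
    (hr : 0 < r) : law f (Metric.closedBall x r)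
      = ballAvg f x r * ENNReal.ofReal (r ^ d * unitBallVol d) := by
  have : 0 < r ^ d * unitBallVol d := mul_pos (pow_pos hr d) (unitBallVol_pos d)
  rw [ballAvg_eq_div, ENNReal.div_mul_cancel (by simpa using this) ENNReal.ofReal_ne_top]

lemma ballAvg_ne_top (f : EuclideanSpace ℝ (Fin d) → ℝ) [IsFiniteMeasure (law f)]
    (x : EuclideanSpace ℝ (Fin d)) {r : ℝ} (hr : 0 < r) : ballAvg f x r ≠ ∞ := by
  have : 0 < r ^ d * unitBallVol d := mul_pos (pow_pos hr d) (unitBallVol_pos d)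
  rw [ballAvg_eq_div]
  exact ENNReal.div_ne_top (measure_ne_top _ _) (by simpa using this)

lemma law_real_closedBall_eq (f : EuclideanSpace ℝ (Fin d) → ℝ) (x : EuclideanSpace ℝ (Fin d))
    {r : ℝ} (hr : 0 < r) : (law f).real (Metric.closedBall x r)
      = (ballAvg f x r).toReal * (r ^ d * unitBallVol d) := by
  have : 0 < r ^ d * unitBallVol d := mul_pos (pow_pos hr d) (unitBallVol_pos d)
  rw [measureReal_def, law_closedBall_eq f x hr, ENNReal.toReal_mul, ENNReal.toReal_ofReal this.le]

/-- Lebesgue differentiation along closed balls, in its Besicovitch form, applied to `law f`. -/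
lemma ae_tendsto_ballAvg (hd : 0 < d) {f : EuclideanSpace ℝ (Fin d) → ℝ}
    (hf : AEMeasurable f volume) [IsFiniteMeasure (law f)] :
    ∀ᵐ x, Tendsto (ballAvg f x) (𝓝[>] 0) (𝓝 (ENNReal.ofReal (f x))) := by
  filter_upwards [Besicovitch.ae_tendsto_rnDeriv (law f) volume,
    Measure.rnDeriv_withDensity₀ volume hf.ennreal_ofReal] with x hx hx'
  rw [hx'] at hx
  refine hx.congr' ?_
  filter_upwards [self_mem_nhdsWithin] with r hr
  rw [ballAvg_eq_div, volume_closedBall_eq hd x (le_of_lt hr)]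

lemma ballAvg_le_maxAvg (f : EuclideanSpace ℝ (Fin d) → ℝ) (x : EuclideanSpace ℝ (Fin d))
    {r R : ℝ} (hr : 0 < r) (hrR : r ≤ R) : ballAvg f x r ≤ maxAvg f x R :=
  le_iSup₂ (f := fun r (_ : r ∈ Set.Ioc 0 R) => ballAvg f x r) r ⟨hr, hrR⟩

lemma minAvg_le_ballAvg (f : EuclideanSpace ℝ (Fin d) → ℝ) (x : EuclideanSpace ℝ (Fin d))
    {r R : ℝ} (hr : 0 < r) (hrR : r ≤ R) : minAvg f x R ≤ ballAvg f x r :=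
  iInf₂_le (f := fun r (_ : r ∈ Set.Ioc 0 R) => ballAvg f x r) r ⟨hr, hrR⟩

lemma ae_le_maxAvg (hd : 0 < d) {f : EuclideanSpace ℝ (Fin d) → ℝ}
    (hf : AEMeasurable f volume) [IsFiniteMeasure (law f)] {R : ℝ} (hR : 0 < R) :
    ∀ᵐ x, ENNReal.ofReal (f x) ≤ maxAvg f x R := by
  filter_upwards [ae_tendsto_ballAvg hd hf] with x hx
  refine le_of_tendsto hx ?_
  filter_upwards [Ioc_mem_nhdsGT hR] with r hr using ballAvg_le_maxAvg f x hr.1 hr.2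

lemma ae_minAvg_le (hd : 0 < d) {f : EuclideanSpace ℝ (Fin d) → ℝ}
    (hf : AEMeasurable f volume) [IsFiniteMeasure (law f)] {R : ℝ} (hR : 0 < R) :
    ∀ᵐ x, minAvg f x R ≤ ENNReal.ofReal (f x) := by
  filter_upwards [ae_tendsto_ballAvg hd hf] with x hx
  refine ge_of_tendsto hx ?_
  filter_upwards [Ioc_mem_nhdsGT hR] with r hr using minAvg_le_ballAvg f x hr.1 hr.2

lemma lintegral_law {f : EuclideanSpace ℝ (Fin d) → ℝ} (hf : AEMeasurable f volume)
    (g : EuclideanSpace ℝ (Fin d) → ℝ≥0∞) :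
    ∫⁻ x, g x ∂law f = ∫⁻ x, g x * ENNReal.ofReal (f x) := by
  rw [lintegral_withDensity_eq_lintegral_mul_non_measurable₀ _ hf.ennreal_ofReal (by simp)]
  simp [mul_comm]

lemma rpow_le_one_add_rpow (x : ℝ≥0∞) {a b : ℝ} (ha : 0 ≤ a) (hab : a ≤ b) :
    x ^ a ≤ 1 + x ^ b := by
  rcases le_total x 1 with h | h
  · exact (ENNReal.rpow_le_one h ha).trans le_self_add
  · exact (ENNReal.rpow_le_rpow_of_exponent_le h hab).trans le_add_self

/-- On a finite measure space a smaller exponent costs only the total mass. This allows one common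
exponent and radius for `Q` and `T`. -/
lemma lintegral_rpow_lt_top_of_le {α : Type*} [MeasurableSpace α] {μ : Measure α}
    [IsFiniteMeasure μ] {g h : α → ℝ≥0∞} (hgh : ∀ x, g x ≤ h x) {a b : ℝ} (ha : 0 ≤ a)
    (hab : a ≤ b) (hh : ∫⁻ x, h x ^ b ∂μ < ∞) : ∫⁻ x, g x ^ a ∂μ < ∞ := by
  calc ∫⁻ x, g x ^ a ∂μ ≤ ∫⁻ x, 1 + h x ^ b ∂μ := lintegral_mono fun x =>
        (ENNReal.rpow_le_rpow (hgh x) ha).trans (rpow_le_one_add_rpow _ ha hab)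
    _ = μ Set.univ + ∫⁻ x, h x ^ b ∂μ := by
        rw [lintegral_add_left measurable_const, lintegral_one]
    _ < ∞ := ENNReal.add_lt_top.2 ⟨measure_lt_top _ _, hh⟩

lemma maxAvg_mono (f : EuclideanSpace ℝ (Fin d) → ℝ) (x : EuclideanSpace ℝ (Fin d)) {R S : ℝ}
    (h : R ≤ S) : maxAvg f x R ≤ maxAvg f x S :=
  iSup₂_le fun _ hr => ballAvg_le_maxAvg f x hr.1 (hr.2.trans h)

lemma minAvg_anti (f : EuclideanSpace ℝ (Fin d) → ℝ) (x : EuclideanSpace ℝ (Fin d)) {R S : ℝ}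
    (h : R ≤ S) : minAvg f x S ≤ minAvg f x R :=
  le_iInf₂ fun _ hr => minAvg_le_ballAvg f x hr.1 (hr.2.trans h)

lemma lintegral_maxAvg_lt_top {f : EuclideanSpace ℝ (Fin d) → ℝ} (hf : AEMeasurable f volume)
    [IsFiniteMeasure (law f)] {ε δ R S : ℝ} (hQ : Q f δ S < ∞) (hε : 0 ≤ ε) (h : ε ≤ δ)
    (hR : R ≤ S) : ∫⁻ x, maxAvg f x R ^ ε ∂law f < ∞ :=
  lintegral_rpow_lt_top_of_le (fun x => maxAvg_mono f x hR) hε h (by rwa [lintegral_law hf])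

lemma lintegral_minAvg_lt_top {f : EuclideanSpace ℝ (Fin d) → ℝ} (hf : AEMeasurable f volume)
    [IsFiniteMeasure (law f)] {ε δ R S : ℝ} (hT : T f δ S < ∞) (hε : 0 ≤ ε) (h : ε ≤ δ)
    (hR : R ≤ S) : ∫⁻ x, minAvg f x R ^ (-ε) ∂law f < ∞ := by
  have := lintegral_rpow_lt_top_of_le (μ := law f)
    (fun x => ENNReal.inv_le_inv.2 (minAvg_anti f x hR)) hε h
    (by simpa only [ENNReal.inv_rpow, ← ENNReal.rpow_neg, lintegral_law hf, T] using hT)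
  simpa only [ENNReal.inv_rpow, ← ENNReal.rpow_neg] using this

lemma abs_log_le_rpow_add {a ε : ℝ} (ha : 0 < a) (hε : 0 < ε) :
    |Real.log a| ≤ (a ^ ε + a ^ (-ε)) / ε := by
  have h1 := Real.log_le_rpow_div ha.le hε
  have h2 := Real.log_le_rpow_div (inv_pos.2 ha).le hε
  rw [Real.log_inv, Real.inv_rpow ha.le, ← Real.rpow_neg ha.le] at h2
  have h3 : 0 ≤ a ^ ε / ε := by positivity
  have h4 : 0 ≤ a ^ (-ε) / ε := by positivity
  rw [add_div, abs_le]
  constructor <;> linarith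

lemma ofReal_abs_log_le {a ε : ℝ} (ha : 0 < a) (hε : 0 < ε) :
    ENNReal.ofReal |Real.log a| ≤ ENNReal.ofReal ε⁻¹ *
      (ENNReal.ofReal a ^ ε + ENNReal.ofReal a ^ (-ε)) := by
  rw [ENNReal.ofReal_rpow_of_pos ha, ENNReal.ofReal_rpow_of_pos ha,
    ← ENNReal.ofReal_add (by positivity) (by positivity), ← ENNReal.ofReal_mul (by positivity)]
  refine ENNReal.ofReal_le_ofReal ((abs_log_le_rpow_add ha hε).trans_eq ?_)
  rw [div_eq_inv_mul]

lemma ae_law_of_ae {f : EuclideanSpace ℝ (Fin d) → ℝ} {p : EuclideanSpace ℝ (Fin d) → Prop}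
    (h : ∀ᵐ x, p x) : ∀ᵐ x ∂law f, p x :=
  (withDensity_absolutelyContinuous _ _).ae_le h

lemma ae_law_pos {f : EuclideanSpace ℝ (Fin d) → ℝ} (hf : AEMeasurable f volume) :
    ∀ᵐ x ∂law f, 0 < f x := by
  rw [ae_withDensity_iff' hf.ennreal_ofReal]
  refine ae_of_all _ fun x hx => ?_
  simpa using hx

/-- By differentiation `f` lies a.e. between `minAvg` and `maxAvg`, and `|log a| ≤ (a^ε + a^{-ε}) /
ε`. -/
lemma integrable_log_law (hd : 0 < d) {f : EuclideanSpace ℝ (Fin d) → ℝ}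
    (hf : AEMeasurable f volume) [IsFiniteMeasure (law f)] {ε R : ℝ} (hε : 0 < ε) (hR : 0 < R)
    (hQ : ∫⁻ x, maxAvg f x R ^ ε ∂law f < ∞) (hT : ∫⁻ x, minAvg f x R ^ (-ε) ∂law f < ∞) :
    Integrable (fun x => Real.log (f x)) (law f) := by
  have hfm : AEMeasurable f (law f) := hf.mono_ac (withDensity_absolutelyContinuous _ _)
  refine ⟨(Real.measurable_log.comp_aemeasurable hfm).aestronglyMeasurable, ?_⟩
  rw [hasFiniteIntegral_iff_norm]
  calc ∫⁻ x, ENNReal.ofReal ‖Real.log (f x)‖ ∂law f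
      ≤ ∫⁻ x, ENNReal.ofReal ε⁻¹ *
        (ENNReal.ofReal (f x) ^ ε + ENNReal.ofReal (f x) ^ (-ε)) ∂law f := by
        refine lintegral_mono_ae ?_
        filter_upwards [ae_law_pos hf] with x hx using ofReal_abs_log_le hx hε
    _ = ENNReal.ofReal ε⁻¹ * (∫⁻ x, ENNReal.ofReal (f x) ^ ε ∂law f
          + ∫⁻ x, ENNReal.ofReal (f x) ^ (-ε) ∂law f) := by
        rw [lintegral_const_mul' _ _ ENNReal.ofReal_ne_top,
          lintegral_add_left' (hfm.ennreal_ofReal.pow_const _)]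
    _ ≤ ENNReal.ofReal ε⁻¹ * (∫⁻ x, maxAvg f x R ^ ε ∂law f
          + ∫⁻ x, minAvg f x R ^ (-ε) ∂law f) := by
        gcongr ENNReal.ofReal ε⁻¹ * (?_ + ?_)
        · refine lintegral_mono_ae ?_
          filter_upwards [ae_law_of_ae (ae_le_maxAvg hd hf hR)] with x hx
          exact ENNReal.rpow_le_rpow hx hε.le
        · refine lintegral_mono_ae ?_
          filter_upwards [ae_law_of_ae (ae_minAvg_le hd hf hR)] with x hx
          rw [ENNReal.rpow_neg, ENNReal.rpow_neg, ENNReal.inv_le_inv]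
          exact ENNReal.rpow_le_rpow hx hε.le
    _ < ∞ := ENNReal.mul_lt_top ENNReal.ofReal_lt_top (ENNReal.add_lt_top.2 ⟨hQ, hT⟩)

lemma integrable_law_iff {f : EuclideanSpace ℝ (Fin d) → ℝ} (hf : AEMeasurable f volume)
    (hf0 : ∀ x, 0 ≤ f x) {g : EuclideanSpace ℝ (Fin d) → ℝ} :
    Integrable g (law f) ↔ Integrable (fun x => f x * g x) volume := by
  rw [integrable_withDensity_iff_integrable_smul₀' hf.ennreal_ofReal (by simp)]
  simp [ENNReal.toReal_ofReal (hf0 _)]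

lemma integral_law {f : EuclideanSpace ℝ (Fin d) → ℝ} (hf : AEMeasurable f volume)
    (hf0 : ∀ x, 0 ≤ f x) (g : EuclideanSpace ℝ (Fin d) → ℝ) :
    ∫ x, g x ∂law f = ∫ x, f x * g x := by
  rw [integral_withDensity_eq_integral_toReal_smul₀ hf.ennreal_ofReal (by simp)]
  simp [ENNReal.toReal_ofReal (hf0 _)]

/-! ### Tail bounds for the nearest-neighbour distance -/

lemma rpow_le_exp {z ε : ℝ} (hz : 0 ≤ z) (hε : 0 ≤ ε) (hε1 : ε ≤ 1) : z ^ ε ≤ Real.exp z := by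
  rcases le_total z 1 with h | h
  · exact (Real.rpow_le_one hz h hε).trans (Real.one_le_exp hz)
  · calc z ^ ε ≤ z ^ (1 : ℝ) := Real.rpow_le_rpow_of_exponent_le h hε1
      _ = z := Real.rpow_one z
      _ ≤ Real.exp z := by linarith [Real.add_one_le_exp z]

lemma ofReal_exp_neg_le_rpow {z ε : ℝ} (hz : 0 ≤ z) (hε : 0 < ε) (hε1 : ε ≤ 1) :
    ENNReal.ofReal (Real.exp (-z)) ≤ ENNReal.ofReal z ^ (-ε) := by
  rw [ENNReal.rpow_neg, ENNReal.ofReal_rpow_of_nonneg hz hε.le, Real.exp_neg,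
    ENNReal.ofReal_inv_of_pos (Real.exp_pos z), ENNReal.inv_le_inv]
  exact ENNReal.ofReal_le_ofReal (rpow_le_exp hz hε.le hε1)

/-- With `p` the mass of the ball, `(1 - p)^(m+1) ≤ exp (-(m+1)p) ≤ ((m+1)p)^{-ε}`, the last step
using `ε ≤ 1`; then `p` is bounded below through `minAvg`. -/
lemma measure_lt_nnDist_le {f : EuclideanSpace ℝ (Fin d) → ℝ}
    [IsProbabilityMeasure (law f)] {ε r R : ℝ} (hε : 0 < ε) (hε1 : ε ≤ 1) (hr : 0 < r)
    (hrR : r ≤ R) (m : ℕ) (i : Fin (m + 2)) :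
    Measure.pi (fun _ : Fin (m + 2) => law f) {x | r < nnDist x i}
      ≤ ENNReal.ofReal (((m : ℝ) + 1) * (r ^ d * unitBallVol d)) ^ (-ε)
        * ∫⁻ x, minAvg f x R ^ (-ε) ∂law f := by
  have hv : 0 < r ^ d * unitBallVol d := mul_pos (pow_pos hr d) (unitBallVol_pos d)
  have hmv : 0 < ((m : ℝ) + 1) * (r ^ d * unitBallVol d) := by positivity
  rw [pi_lt_nnDist, ← lintegral_const_mul' _ _
    (by rw [ENNReal.ofReal_rpow_of_pos hmv]; exact ENNReal.ofReal_ne_top)]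
  refine lintegral_mono fun x => ?_
  have hm := minAvg_le_ballAvg f x hr hrR
  have hb := ballAvg_ne_top f x hr
  rw [← ENNReal.mul_rpow_of_ne_top ENNReal.ofReal_ne_top (ne_top_of_le_ne_top hb hm)]
  set a := (ballAvg f x r).toReal with ha
  have hp := law_real_closedBall_eq f x hr
  have hp1 : (law f).real (Metric.closedBall x r) ≤ 1 := measureReal_le_one
  have ha0 : 0 ≤ a := ENNReal.toReal_nonneg
  calc ENNReal.ofReal ((1 - (law f).real (Metric.closedBall x r)) ^ (m + 1))
      ≤ ENNReal.ofReal (Real.exp (-(((m : ℝ) + 1) * (r ^ d * unitBallVol d) * a))) := by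
        refine ENNReal.ofReal_le_ofReal ?_
        calc (1 - (law f).real (Metric.closedBall x r)) ^ (m + 1)
            ≤ Real.exp (-(law f).real (Metric.closedBall x r)) ^ (m + 1) :=
              pow_le_pow_left₀ (by linarith) (Real.one_sub_le_exp_neg _) _
          _ = _ := by
              rw [← Real.exp_nat_mul, hp]
              congr 1
              push_cast
              ring
    _ ≤ ENNReal.ofReal (((m : ℝ) + 1) * (r ^ d * unitBallVol d) * a) ^ (-ε) :=
        ofReal_exp_neg_le_rpow (by positivity) hε hε1
    _ ≤ _ := by
        rw [ENNReal.rpow_neg, ENNReal.rpow_neg, ENNReal.inv_le_inv]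
        refine ENNReal.rpow_le_rpow ?_ hε.le
        rw [ENNReal.ofReal_mul hmv.le, ha, ENNReal.ofReal_toReal hb]
        gcongr

/-- With `z = (m+1)p`, Bernoulli's inequality gives `1 - (1 - p)^(m+1) ≤ min 1 z ≤ z^ε` for `ε ≤ 1`;
then `p` is bounded above through `maxAvg`. -/
lemma measure_nnDist_le_le {f : EuclideanSpace ℝ (Fin d) → ℝ}
    [IsProbabilityMeasure (law f)] {ε r R : ℝ} (hε : 0 < ε) (hε1 : ε ≤ 1) (hr : 0 < r)
    (hrR : r ≤ R) (m : ℕ) (i : Fin (m + 2)) :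
    Measure.pi (fun _ : Fin (m + 2) => law f) {x | nnDist x i ≤ r}
      ≤ ENNReal.ofReal (((m : ℝ) + 1) * (r ^ d * unitBallVol d)) ^ ε
        * ∫⁻ x, maxAvg f x R ^ ε ∂law f := by
  have hv : 0 < r ^ d * unitBallVol d := mul_pos (pow_pos hr d) (unitBallVol_pos d)
  have hmv : 0 < ((m : ℝ) + 1) * (r ^ d * unitBallVol d) := by positivity
  have hcompl : {x : Fin (m + 2) → EuclideanSpace ℝ (Fin d) | nnDist x i ≤ r}
      = {x | r < nnDist x i}ᶜ := by ext; simp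
  have hmeas : MeasurableSet {x : Fin (m + 2) → EuclideanSpace ℝ (Fin d) | r < nnDist x i} :=
    measurableSet_lt measurable_const (measurable_nnDist i)
  have hball : Measurable fun x => ENNReal.ofReal
      ((1 - (law f).real (Metric.closedBall x r)) ^ (m + 1)) :=
    ((measurable_const.sub (measurable_measure_closedBall (law f) r).ennreal_toReal).pow_const
      _).ennreal_ofReal
  have h01 : ∀ x, 0 ≤ 1 - (law f).real (Metric.closedBall x r) := fun x =>
    sub_nonneg.2 measureReal_le_one
  rw [hcompl, prob_compl_eq_one_sub hmeas, pi_lt_nnDist, ← lintegral_const_mul' _ _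
    (ENNReal.rpow_ne_top_of_nonneg hε.le ENNReal.ofReal_ne_top)]
  have hle1 : ∀ x, ENNReal.ofReal ((1 - (law f).real (Metric.closedBall x r)) ^ (m + 1)) ≤ 1 :=
    fun x => by
      rw [ENNReal.ofReal_le_one]
      exact pow_le_one₀ (h01 x) (sub_le_self _ measureReal_nonneg)
  have hone : (1 : ℝ≥0∞) = ∫⁻ _, 1 ∂law f := by simp
  rw [hone, ← lintegral_sub hball ?_ (ae_of_all _ hle1)]
  swap
  · refine ne_top_of_le_ne_top ENNReal.one_ne_top ((lintegral_mono hle1).trans_eq hone.symm)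
  refine lintegral_mono fun x => ?_
  have hM := ballAvg_le_maxAvg f x hr hrR
  have hb := ballAvg_ne_top f x hr
  rw [← ENNReal.mul_rpow_of_nonneg _ _ hε.le]
  set a := (ballAvg f x r).toReal with ha
  have hp := law_real_closedBall_eq f x hr
  have ha0 : 0 ≤ a := ENNReal.toReal_nonneg
  set z := ((m : ℝ) + 1) * (r ^ d * unitBallVol d) * a with hz
  have hz0 : 0 ≤ z := by positivity
  calc 1 - ENNReal.ofReal ((1 - (law f).real (Metric.closedBall x r)) ^ (m + 1))
      ≤ ENNReal.ofReal (z ^ ε) := by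
        rw [tsub_le_iff_right, ← ENNReal.ofReal_add (by positivity) (pow_nonneg (h01 x) _),
          ENNReal.one_le_ofReal]
        have hpow := pow_nonneg (h01 x) (m + 1)
        rcases le_total 1 z with h | h
        · linarith [Real.one_le_rpow h hε.le]
        · have h1 : z ≤ z ^ ε := by
            conv_lhs => rw [← Real.rpow_one z]
            exact Real.rpow_le_rpow_of_exponent_ge_of_imp hz0 h hε1 (by intro _ h; simp at h)
          have h2 := one_add_mul_le_pow (a := -(law f).real (Metric.closedBall x r))
            (by linarith [h01 x]) (m + 1)
          have h3 : ((m + 1 : ℕ) : ℝ) * -(law f).real (Metric.closedBall x r) = -z := by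
            rw [hp, hz]
            push_cast
            ring
          rw [h3, ← sub_eq_add_neg, ← sub_eq_add_neg] at h2
          linarith
    _ = ENNReal.ofReal z ^ ε := (ENNReal.ofReal_rpow_of_nonneg hz0 hε.le).symm
    _ ≤ _ := by
        refine ENNReal.rpow_le_rpow ?_ hε.le
        rw [hz, ENNReal.ofReal_mul hmv.le, ha, ENNReal.ofReal_toReal hb]
        gcongr

/-! ### Normalized nearest-neighbour volumes and their limiting distribution -/

/-- The radius of a ball of volume `exp s / (m + 1)`. -/
def radius (d m : ℕ) (s : ℝ) : ℝ := (Real.exp s / ((m + 1) * unitBallVol d)) ^ ((d : ℝ)⁻¹)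

/-- The logarithm of `m + 1` times the volume of a ball of radius `r`. -/
def logVol (d m : ℕ) (r : ℝ) : ℝ := Real.log ((m + 1) * (r ^ d * unitBallVol d))

lemma radius_pos (d m : ℕ) (s : ℝ) : 0 < radius d m s := by
  have := unitBallVol_pos d
  exact Real.rpow_pos_of_pos (by positivity) _

lemma radius_pow (hd : 0 < d) (m : ℕ) (s : ℝ) :
    ((m : ℝ) + 1) * (radius d m s ^ d * unitBallVol d) = Real.exp s := by
  have hV := unitBallVol_pos d
  rw [radius, Real.rpow_inv_natCast_pow (by positivity) hd.ne']
  field_simp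

/-- Positivity of `r` matters: `logVol d m 0` is `0` by the convention for `Real.log`, not `-∞`. -/
lemma lt_logVol_iff (hd : 0 < d) (m : ℕ) (s : ℝ) {r : ℝ} (hr : 0 < r) :
    s < logVol d m r ↔ radius d m s < r := by
  have hV := unitBallVol_pos d
  rw [logVol, Real.lt_log_iff_exp_lt (by positivity), ← radius_pow hd m s,
    mul_lt_mul_iff_right₀ (by positivity), mul_lt_mul_iff_left₀ hV,
    pow_lt_pow_iff_left₀ (radius_pos d m s).le hr.le hd.ne']

lemma radius_le_iff (hd : 0 < d) (m : ℕ) (s : ℝ) {r : ℝ} (hr : 0 < r) :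
    radius d m s ≤ r ↔ Real.exp s ≤ (m + 1) * (r ^ d * unitBallVol d) := by
  have hV := unitBallVol_pos d
  rw [← radius_pow hd m s, mul_le_mul_iff_right₀ (by positivity), mul_le_mul_iff_left₀ hV,
    pow_le_pow_iff_left₀ (radius_pos d m s).le hr.le hd.ne']

lemma measurable_logVol (d m : ℕ) : Measurable (logVol d m) := by
  unfold logVol
  fun_prop

lemma tendsto_radius (hd : 0 < d) (s : ℝ) :
    Tendsto (fun m => radius d m s) atTop (𝓝[>] 0) := by
  refine tendsto_nhdsWithin_iff.2 ⟨?_, Eventually.of_forall fun m => radius_pos d m s⟩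
  have h1 : Tendsto (fun m : ℕ => Real.exp s / (((m : ℝ) + 1) * unitBallVol d)) atTop (𝓝 0) :=
    tendsto_const_nhds.div_atTop (Tendsto.atTop_mul_const (unitBallVol_pos d)
      (tendsto_atTop_add_const_right _ _ tendsto_natCast_atTop_atTop))
  have h2 := h1.rpow_const (p := (d : ℝ)⁻¹) (Or.inr (by positivity))
  rwa [Real.zero_rpow (by positivity)] at h2

/-- The law has no atoms, so a ball of radius `0` has mass `0` and `pi_lt_nnDist` at `r = 0` gives
probability one. -/
lemma ae_nnDist_pos (hd : 0 < d) {f : EuclideanSpace ℝ (Fin d) → ℝ} [IsProbabilityMeasure (law f)]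
    (m : ℕ) : ∀ᵐ x ∂Measure.pi (fun _ : Fin (m + 2) => law f), ∀ i, 0 < nnDist x i := by
  rw [ae_all_iff]
  intro i
  refine (mem_ae_iff_prob_eq_one (measurableSet_lt measurable_const (measurable_nnDist i))).2 ?_
  have : Nonempty (Fin d) := ⟨⟨0, hd⟩⟩
  refine (pi_lt_nnDist (law f) m i 0).trans ?_
  have h0 : ∀ x : EuclideanSpace ℝ (Fin d), (law f).real {x} = 0 := fun x => by
    rw [measureReal_def, withDensity_absolutelyContinuous volume _ (measure_singleton x)]
    rfl
  simp [Metric.closedBall_zero, h0]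

/-- The Poisson limit of void probabilities. Exponent `m` serves pairs of sample points and `m + 1`
single points; they differ by a factor tending to `1`. -/
lemma tendsto_one_sub_pow_exp {p : ℕ → ℝ} {t : ℝ}
    (h : Tendsto (fun m : ℕ => ((m : ℝ) + 1) * p m) atTop (𝓝 t)) :
    Tendsto p atTop (𝓝 0) ∧ Tendsto (fun m => (1 - p m) ^ m) atTop (𝓝 (Real.exp (-t))) ∧
      Tendsto (fun m => (1 - p m) ^ (m + 1)) atTop (𝓝 (Real.exp (-t))) := by
  have h0 : Tendsto p atTop (𝓝 0) := by
    have := h.mul (tendsto_one_div_add_atTop_nhds_zero_nat (𝕜 := ℝ))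
    rw [mul_zero] at this
    refine this.congr fun m => ?_
    field_simp
  have h1 : Tendsto (fun m : ℕ => (m : ℝ) * -p m) atTop (𝓝 (-t)) := by
    have := (h.sub h0).neg
    rw [sub_zero] at this
    refine this.congr fun m => ?_
    ring
  have h2 := Real.tendsto_one_add_pow_exp_of_tendsto h1
  simp only [← sub_eq_add_neg] at h2
  refine ⟨h0, h2, ?_⟩
  have h3 := h2.mul (tendsto_const_nhds (x := (1 : ℝ)) |>.sub h0)
  simpa only [sub_zero, mul_one, ← pow_succ] using h3

lemma tendsto_mul_law_real_closedBall (hd : 0 < d) {f : EuclideanSpace ℝ (Fin d) → ℝ}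
    (hf0 : ∀ x, 0 ≤ f x) (s : ℝ) {x : EuclideanSpace ℝ (Fin d)}
    (hx : Tendsto (ballAvg f x) (𝓝[>] 0) (𝓝 (ENNReal.ofReal (f x)))) :
    Tendsto (fun m : ℕ => ((m : ℝ) + 1) * (law f).real (Metric.closedBall x (radius d m s))) atTop
      (𝓝 (Real.exp s * f x)) := by
  have h1 := (ENNReal.tendsto_toReal ENNReal.ofReal_ne_top).comp (hx.comp (tendsto_radius hd s))
  rw [ENNReal.toReal_ofReal (hf0 x)] at h1
  refine (h1.const_mul (Real.exp s)).congr fun m => ?_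
  rw [law_real_closedBall_eq f x (radius_pos d m s), ← radius_pow hd m s]
  simp only [Function.comp_apply]
  ring

/-- The limiting survival function of the logarithms of the normalized volumes. -/
def limitSurvival (f : EuclideanSpace ℝ (Fin d) → ℝ) (s : ℝ) : ℝ≥0∞ :=
  ∫⁻ x, ENNReal.ofReal (Real.exp (-(Real.exp s * f x))) ∂law f

lemma limitSurvival_le_one {f : EuclideanSpace ℝ (Fin d) → ℝ} (hf0 : ∀ x, 0 ≤ f x)
    [IsProbabilityMeasure (law f)] (s : ℝ) : limitSurvival f s ≤ 1 := by
  refine (lintegral_mono (g := 1) fun x => ?_).trans_eq (by simp)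
  rw [Pi.one_apply, ENNReal.ofReal_le_one, Real.exp_le_one_iff, neg_nonpos]
  exact mul_nonneg (Real.exp_pos s).le (hf0 x)

lemma tendsto_measure_lt_nnDist (hd : 0 < d) {f : EuclideanSpace ℝ (Fin d) → ℝ}
    (hf : AEMeasurable f volume) (hf0 : ∀ x, 0 ≤ f x) [IsProbabilityMeasure (law f)] (s : ℝ) :
    Tendsto (fun m => Measure.pi (fun _ : Fin (m + 2) => law f)
      {x | radius d m s < nnDist x 0}) atTop (𝓝 (limitSurvival f s)) := by
  simp_rw [pi_lt_nnDist]
  refine tendsto_lintegral_of_dominated_convergence (fun _ => 1) (fun m => ?_) (fun m => ?_)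
    (by simp) ?_
  · exact ((measurable_const.sub
      (measurable_measure_closedBall (law f) _).ennreal_toReal).pow_const _).ennreal_ofReal
  · refine ae_of_all _ fun x => ?_
    rw [ENNReal.ofReal_le_one]
    exact pow_le_one₀ (sub_nonneg.2 measureReal_le_one) (sub_le_self _ measureReal_nonneg)
  · filter_upwards [ae_law_of_ae (ae_tendsto_ballAvg hd hf)] with x hx
    exact ENNReal.tendsto_ofReal
      (tendsto_one_sub_pow_exp (tendsto_mul_law_real_closedBall hd hf0 s hx)).2.2

/-- The source of asymptotic independence: once the radius is below half the distance of the
centres, the balls are disjoint, their masses add, and the exponential limit factorizes. -/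
lemma tendsto_pair_kernel (hd : 0 < d) {f : EuclideanSpace ℝ (Fin d) → ℝ}
    (hf0 : ∀ x, 0 ≤ f x) [IsProbabilityMeasure (law f)] (s : ℝ)
    {x y : EuclideanSpace ℝ (Fin d)} (hxy : x ≠ y)
    (hx : Tendsto (ballAvg f x) (𝓝[>] 0) (𝓝 (ENNReal.ofReal (f x))))
    (hy : Tendsto (ballAvg f y) (𝓝[>] 0) (𝓝 (ENNReal.ofReal (f y)))) :
    Tendsto (fun m => {p : EuclideanSpace ℝ (Fin d) × EuclideanSpace ℝ (Fin d) |
          radius d m s < dist p.1 p.2}.indicator 1 (x, y)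
        * law f (Metric.closedBall x (radius d m s) ∪ Metric.closedBall y (radius d m s))ᶜ ^ m)
      atTop (𝓝 (ENNReal.ofReal (Real.exp (-(Real.exp s * f x)))
        * ENNReal.ofReal (Real.exp (-(Real.exp s * f y))))) := by
  have h1 := (tendsto_mul_law_real_closedBall hd hf0 s hx).add
    (tendsto_mul_law_real_closedBall hd hf0 s hy)
  simp only [← mul_add] at h1
  have h2 := ENNReal.tendsto_ofReal (tendsto_one_sub_pow_exp h1).2.1
  rw [← ENNReal.ofReal_mul (Real.exp_pos _).le, ← Real.exp_add, ← neg_add, ← mul_add]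
  refine h2.congr' ?_
  have hsmall : ∀ᶠ m in atTop, radius d m s < dist x y / 2 :=
    (tendsto_nhdsWithin_iff.1 (tendsto_radius hd s)).1.eventually_lt_const
      (half_pos (dist_pos.2 hxy))
  filter_upwards [hsmall] with m hm
  have hr := radius_pos d m s
  rw [Set.indicator_of_mem (by change radius d m s < dist x y; linarith), Pi.one_apply, one_mul]
  have hdisj : Disjoint (Metric.closedBall x (radius d m s)) (Metric.closedBall y (radius d m s)) :=
    Metric.closedBall_disjoint_closedBall (by linarith)
  rw [← measureReal_union hdisj Metric.isClosed_closedBall.measurableSet,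
    ← probReal_compl_eq_one_sub (Metric.isClosed_closedBall.measurableSet.union
      Metric.isClosed_closedBall.measurableSet), ENNReal.ofReal_pow measureReal_nonneg,
    ofReal_measureReal]

lemma tendsto_measure_lt_nnDist_pair (hd : 0 < d) {f : EuclideanSpace ℝ (Fin d) → ℝ}
    (hf : AEMeasurable f volume) (hf0 : ∀ x, 0 ≤ f x) [IsProbabilityMeasure (law f)] (s : ℝ) :
    Tendsto (fun m => Measure.pi (fun _ : Fin (m + 2) => law f)
      {x | radius d m s < nnDist x 0 ∧ radius d m s < nnDist x 1}) atTop
      (𝓝 (limitSurvival f s ^ 2)) := by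
  have : Nonempty (Fin d) := ⟨⟨0, hd⟩⟩
  simp_rw [fun m : ℕ => pi_lt_nnDist_pair (law f) m (i := 0) (j := 1) (by simp) (radius d m s)]
  have hΦ : ∀ m, Measurable fun p : EuclideanSpace ℝ (Fin d) × EuclideanSpace ℝ (Fin d) =>
      {p : EuclideanSpace ℝ (Fin d) × EuclideanSpace ℝ (Fin d) |
          radius d m s < dist p.1 p.2}.indicator
            (1 : EuclideanSpace ℝ (Fin d) × EuclideanSpace ℝ (Fin d) → ℝ≥0∞) p
        * law f (Metric.closedBall p.1 (radius d m s) ∪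
          Metric.closedBall p.2 (radius d m s))ᶜ ^ m := by
    intro m
    refine (measurable_one.indicator (measurableSet_lt measurable_const measurable_dist)).mul
      (Measurable.pow_const ?_ _)
    have hS : MeasurableSet {q : (EuclideanSpace ℝ (Fin d) × EuclideanSpace ℝ (Fin d)) ×
        EuclideanSpace ℝ (Fin d) | q.2 ∈ (Metric.closedBall q.1.1 (radius d m s) ∪
          Metric.closedBall q.1.2 (radius d m s))ᶜ} := by
      refine MeasurableSet.compl (MeasurableSet.union ?_ ?_)
      · exact measurableSet_le (measurable_snd.dist (measurable_fst.comp measurable_fst))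
          measurable_const
      · exact measurableSet_le (measurable_snd.dist (measurable_snd.comp measurable_fst))
          measurable_const
    exact measurable_measure_prodMk_left hS
  have hΦ1 : ∀ m (x y : EuclideanSpace ℝ (Fin d)),
      {p : EuclideanSpace ℝ (Fin d) × EuclideanSpace ℝ (Fin d) |
          radius d m s < dist p.1 p.2}.indicator
            (1 : EuclideanSpace ℝ (Fin d) × EuclideanSpace ℝ (Fin d) → ℝ≥0∞) (x, y)
        * law f (Metric.closedBall x (radius d m s) ∪
          Metric.closedBall y (radius d m s))ᶜ ^ m ≤ 1 := by
    intro m x y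
    refine mul_le_one' ?_ (pow_le_one' prob_le_one _)
    exact Set.indicator_le_self _ _ _
  have hLD := ae_law_of_ae (f := f) (ae_tendsto_ballAvg hd hf)
  have hlim : limitSurvival f s ^ 2 = ∫⁻ x, ∫⁻ y,
      ENNReal.ofReal (Real.exp (-(Real.exp s * f x)))
        * ENNReal.ofReal (Real.exp (-(Real.exp s * f y))) ∂law f ∂law f := by
    simp_rw [lintegral_const_mul' _ _ ENNReal.ofReal_ne_top]
    have hne : limitSurvival f s ≠ ∞ := ne_top_of_le_ne_top ENNReal.one_ne_top
      (limitSurvival_le_one hf0 s)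
    change _ = ∫⁻ x, _ * limitSurvival f s ∂law f
    rw [lintegral_mul_const' _ _ hne, sq]
    rfl
  rw [hlim]
  refine tendsto_lintegral_of_dominated_convergence (fun _ => 1)
    (fun m => (hΦ m).lintegral_prod_right') (fun m => ae_of_all _ fun x => ?_) (by simp) ?_
  · exact (lintegral_mono (hΦ1 m x)).trans_eq (by simp)
  filter_upwards [hLD] with x hx
  refine tendsto_lintegral_of_dominated_convergence (fun _ => 1)
    (fun m => (hΦ m).comp measurable_prodMk_left) (fun m => ae_of_all _ (hΦ1 m x)) (by simp) ?_
  -- The kernel limit needs distinct centres; the diagonal is null.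
  have hne : ∀ᵐ y ∂law f, y ≠ x :=
    ae_law_of_ae (measure_eq_zero_iff_ae_notMem.1 (measure_singleton x))
  filter_upwards [hLD, hne] with y hy hxy
  exact tendsto_pair_kernel hd hf0 s hxy.symm hx hy

/-! ### Truncation and the limiting mean -/

/-- Truncation of `w` to the interval `[-A, A]`. -/
def clamp (A w : ℝ) : ℝ := max (-A) (min A w)

lemma abs_clamp_le {A : ℝ} (hA : 0 ≤ A) (w : ℝ) : |clamp A w| ≤ |w| := by
  unfold clamp
  rcases abs_cases w with ⟨h1, h2⟩ | ⟨h1, h2⟩ <;> rw [h1, abs_le] <;>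
    constructor <;> simp only [max_def, min_def] <;> split_ifs <;> linarith

lemma abs_sub_clamp {A : ℝ} (hA : 0 ≤ A) (w : ℝ) : |w - clamp A w| = max (|w| - A) 0 := by
  unfold clamp
  grind

lemma clamp_eq_self {A w : ℝ} (h : |w| ≤ A) : clamp A w = w := by
  rw [abs_le] at h
  rw [clamp, min_eq_right h.2, max_eq_right h.1]

lemma measurable_clamp (A : ℝ) : Measurable (clamp A) := by
  unfold clamp
  fun_prop

/-- Layer-cake formula for the truncation. -/
lemma setIntegral_indicator_Iio (A w : ℝ) :
    ∫ s in Set.Ioc (-A) A, (Set.Iio w).indicator (fun _ => (1 : ℝ)) s = clamp A w + A := by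
  have h : (Set.Iio w ∩ Set.Ioc (-A) A : Set ℝ) =ᵐ[volume] Set.Ioc (-A) (min A w) := by
    rw [← Set.Ioc_inter_Iic, Set.inter_comm]
    exact (ae_eq_refl _).inter Iio_ae_eq_Iic
  rw [integral_indicator measurableSet_Iio, Measure.restrict_restrict measurableSet_Iio,
    setIntegral_const, measureReal_congr h, Real.volume_real_Ioc, smul_eq_mul, mul_one, clamp,
    ← max_add_add_right]
  rw [max_comm]
  congr 1 <;> ring

/-- The standard exponential distribution. -/
def expLaw : Measure ℝ :=
  (volume.restrict (Set.Ioi 0)).withDensity fun t => ENNReal.ofReal (Real.exp (-t))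

lemma expLaw_Ioi {b : ℝ} (hb : 0 ≤ b) :
    expLaw (Set.Ioi b) = ENNReal.ofReal (Real.exp (-b)) := by
  rw [expLaw, withDensity_apply _ measurableSet_Ioi, Measure.restrict_restrict measurableSet_Ioi,
    Set.inter_eq_left.2 (Set.Ioi_subset_Ioi hb), ← ofReal_integral_eq_lintegral_ofReal
    (by simpa [IntegrableOn] using exp_neg_integrableOn_Ioi b one_pos)
    (ae_of_all _ fun t => (Real.exp_pos _).le), integral_exp_neg_Ioi]

lemma ae_expLaw_pos : ∀ᵐ t ∂expLaw, 0 < t :=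
  (withDensity_absolutelyContinuous _ _).ae_le (ae_restrict_mem measurableSet_Ioi)

instance : IsProbabilityMeasure expLaw where
  measure_univ := by
    have h : expLaw (Set.Ioi 0) = expLaw Set.univ := measure_congr (by
      filter_upwards [ae_expLaw_pos] with t ht
      exact propext ⟨fun _ => trivial, fun _ => ht⟩)
    rw [← h, expLaw_Ioi le_rfl, neg_zero, Real.exp_zero, ENNReal.ofReal_one]

lemma integrableOn_log_mul_exp_neg :
    IntegrableOn (fun t => Real.log t * Real.exp (-t)) (Set.Ioi 0) := by
  -- `|log t| ≤ 2 (t^{1/2} + t^{-1/2})`, and these powers times `exp (-t)` are the integrands of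
  -- `Γ(3/2)` and `Γ(1/2)`.
  have h := ((Real.GammaIntegral_convergent (s := 3 / 2) (by norm_num)).add
    (Real.GammaIntegral_convergent (s := 1 / 2) (by norm_num))).const_mul 2
  refine Integrable.mono' h (by fun_prop) ?_
  filter_upwards [ae_restrict_mem measurableSet_Ioi] with t ht
  have h1 := abs_log_le_rpow_add (a := t) (ε := 1 / 2) ht (by norm_num)
  rw [norm_mul, Real.norm_eq_abs, Real.norm_of_nonneg (Real.exp_pos _).le]
  refine (mul_le_mul_of_nonneg_right h1 (Real.exp_pos _).le).trans_eq ?_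
  simp only [Pi.add_apply]
  norm_num
  ring

lemma integrable_log_expLaw : Integrable Real.log expLaw := by
  rw [expLaw, integrable_withDensity_iff_integrable_smul₀' (by fun_prop) (by simp)]
  simpa [ENNReal.toReal_ofReal (Real.exp_pos _).le, mul_comm, IntegrableOn] using
    integrableOn_log_mul_exp_neg

/-- Differentiating the Gamma integral at `1` under the integral sign gives `∫ log t · exp (-t) dt`,
and `Γ'(1) = -γ`. -/
lemma integral_log_expLaw : ∫ t, Real.log t ∂expLaw = -Real.eulerMascheroniConstant := by
  rw [expLaw, integral_withDensity_eq_integral_toReal_smul₀ (by fun_prop) (by simp)]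
  have h1 := Complex.hasDerivAt_GammaIntegral (s := 1) (by simp)
  have h2 : HasDerivAt Complex.GammaIntegral (-(Real.eulerMascheroniConstant : ℂ)) 1 := by
    refine Complex.hasDerivAt_Gamma_one.congr_of_eventuallyEq ?_
    have : {z : ℂ | 0 < z.re} ∈ 𝓝 (1 : ℂ) :=
      (isOpen_lt continuous_const Complex.continuous_re).mem_nhds (by simp)
    filter_upwards [this] with z hz using (Complex.Gamma_eq_integral hz).symm
  have h3 := h1.unique h2
  simp only [sub_self, Complex.cpow_zero, one_mul, ← Complex.ofReal_mul, ← Complex.ofReal_neg,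
    integral_complex_ofReal] at h3
  rw [← Complex.ofReal_inj.1 h3]
  simp [ENNReal.toReal_ofReal (Real.exp_pos _).le, mul_comm]

/-- The integral of `exp (-a exp s)` is the truncated mean of `log (τ / a)`, with `τ` standard
exponential. -/
lemma setIntegral_exp_neg_mul_exp {a : ℝ} (ha : 0 < a) (A : ℝ) :
    ∫ s in Set.Ioc (-A) A, Real.exp (-(Real.exp s * a))
      = ∫ t, (clamp A (Real.log t - Real.log a) + A) ∂expLaw := by
  have h1 : ∀ s : ℝ, Real.exp (-(Real.exp s * a))
      = ∫ t, (Set.Ioi (Real.exp s * a)).indicator (fun _ => (1 : ℝ)) t ∂expLaw := fun s => by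
    rw [integral_indicator_const _ measurableSet_Ioi, smul_eq_mul, mul_one, measureReal_def,
      expLaw_Ioi (by positivity), ENNReal.toReal_ofReal (Real.exp_pos _).le]
  have hmeas : MeasurableSet {p : ℝ × ℝ | Real.exp p.1 * a < p.2} :=
    measurableSet_lt (by fun_prop) (by fun_prop)
  simp_rw [h1]
  -- Fubini: for `t > 0` the event `t > e^s a` is `s < log t - log a`, so the integral over `s` is
  -- the layer-cake formula for the clamp.
  rw [integral_integral_swap]
  · refine integral_congr_ae ?_
    filter_upwards [ae_expLaw_pos] with t ht
    rw [← setIntegral_indicator_Iio A]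
    refine integral_congr_ae (ae_of_all _ fun s => ?_)
    simp only [Set.indicator_apply, Set.mem_Ioi, Set.mem_Iio]
    congr 1
    rw [← Real.log_div ht.ne' ha.ne', Real.lt_log_iff_exp_lt (by positivity), lt_div_iff₀ ha]
  · refine Integrable.of_bound (C := 1) ?_ (ae_of_all _ fun p => ?_)
    · exact (measurable_const.indicator hmeas).aestronglyMeasurable (f :=
        {p : ℝ × ℝ | Real.exp p.1 * a < p.2}.indicator fun _ => (1 : ℝ))
    · simp only [Function.uncurry, Set.indicator_apply]
      split_ifs <;> simp

lemma tendsto_clamp (w : ℝ) : Tendsto (fun n : ℕ => clamp n w) atTop (𝓝 w) := by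
  refine tendsto_const_nhds.congr' ?_
  filter_upwards [eventually_ge_atTop ⌈|w|⌉₊] with n hn
  exact (clamp_eq_self ((Nat.le_ceil _).trans (by exact_mod_cast hn))).symm

lemma toReal_limitSurvival {f : EuclideanSpace ℝ (Fin d) → ℝ}
    (hf : AEMeasurable f volume) (s : ℝ) :
    (limitSurvival f s).toReal = ∫ x, Real.exp (-(Real.exp s * f x)) ∂law f := by
  have hfm : AEMeasurable f (law f) := hf.mono_ac (withDensity_absolutelyContinuous _ _)
  rw [limitSurvival, integral_eq_lintegral_of_nonneg_ae (ae_of_all _ fun x => (Real.exp_pos _).le)]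
  exact (Real.measurable_exp.comp_aemeasurable (hfm.const_mul _).neg).aestronglyMeasurable

/-- The mean of the truncated limiting distribution. -/
def truncMean (f : EuclideanSpace ℝ (Fin d) → ℝ) (A : ℝ) : ℝ :=
  (∫ s in Set.Ioc (-A) A, (limitSurvival f s).toReal) - A

lemma integrable_prod_exp_neg {f : EuclideanSpace ℝ (Fin d) → ℝ} (hf : AEMeasurable f volume)
    (hf0 : ∀ x, 0 ≤ f x) [IsProbabilityMeasure (law f)] (A : ℝ) :
    Integrable (Function.uncurry fun (s : ℝ) x => Real.exp (-(Real.exp s * f x)))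
      ((volume.restrict (Set.Ioc (-A) A)).prod (law f)) := by
  have hfm : AEMeasurable f (law f) := hf.mono_ac (withDensity_absolutelyContinuous _ _)
  refine Integrable.of_bound (C := 1) ?_ (ae_of_all _ fun p => ?_)
  · have : AEMeasurable (fun p : ℝ × EuclideanSpace ℝ (Fin d) => f p.2)
        ((volume.restrict (Set.Ioc (-A) A)).prod (law f)) := hfm.comp_snd
    exact (Real.measurable_exp.comp_aemeasurable
      (((Real.measurable_exp.comp measurable_fst).aemeasurable.mul this).neg)).aestronglyMeasurable
  · rw [Function.uncurry, Real.norm_of_nonneg (Real.exp_pos _).le, Real.exp_le_one_iff, neg_nonpos]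
    exact mul_nonneg (Real.exp_pos _).le (hf0 _)

lemma integrable_clamp_log_sub {A : ℝ} (hA : 0 ≤ A) (b : ℝ) :
    Integrable (fun t => clamp A (Real.log t - b)) expLaw :=
  Integrable.mono' (integrable_log_expLaw.sub (integrable_const b)).norm
    ((measurable_clamp A).comp (by fun_prop)).aestronglyMeasurable
    (ae_of_all _ fun _ => abs_clamp_le hA _)

/-- `truncMean f A` is the expectation of `clamp A (log τ - log f(X))`. Dominated convergence in
`τ`, then in `X` with bound `E|log τ| + |log f(X)|`, removes the clamp. -/
lemma tendsto_truncMean {f : EuclideanSpace ℝ (Fin d) → ℝ} (hf : AEMeasurable f volume)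
    (hf0 : ∀ x, 0 ≤ f x) [IsProbabilityMeasure (law f)]
    (hlog : Integrable (fun x => Real.log (f x)) (law f)) :
    Tendsto (fun n : ℕ => truncMean f n) atTop
      (𝓝 (entropy f - Real.eulerMascheroniConstant)) := by
  have hprod := integrable_prod_exp_neg hf hf0
  have hint₀ : ∀ A : ℝ, Integrable
      (fun x => ∫ s in Set.Ioc (-A) A, Real.exp (-(Real.exp s * f x))) (law f) :=
    fun A => (hprod A).integral_prod_right
  have hint : ∀ A : ℝ, Integrable
      (fun x => (∫ s in Set.Ioc (-A) A, Real.exp (-(Real.exp s * f x))) - A) (law f) :=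
    fun A => (hint₀ A).sub (integrable_const A)
  have hmean : ∀ A : ℝ, truncMean f A
      = ∫ x, ((∫ s in Set.Ioc (-A) A, Real.exp (-(Real.exp s * f x))) - A) ∂law f := fun A => by
    simp_rw [truncMean, toReal_limitSurvival hf]
    rw [integral_integral_swap (hprod A),
      integral_sub (hint₀ A) (integrable_const A)]
    simp
  have hclamp : ∀ n : ℕ, ∀ x, 0 < f x →
      (∫ s in Set.Ioc (-(n : ℝ)) n, Real.exp (-(Real.exp s * f x))) - n
        = ∫ t, clamp n (Real.log t - Real.log (f x)) ∂expLaw := fun n x hx => by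
    rw [setIntegral_exp_neg_mul_exp hx,
      integral_add (integrable_clamp_log_sub n.cast_nonneg _) (integrable_const _)]
    simp
  have hH : entropy f - Real.eulerMascheroniConstant
      = ∫ x, (-Real.eulerMascheroniConstant - Real.log (f x)) ∂law f := by
    rw [integral_sub (integrable_const _) hlog, integral_law hf hf0 fun x => Real.log (f x), entropy]
    simp
    ring
  rw [hH]
  simp_rw [hmean]
  refine tendsto_integral_of_dominated_convergence
    (fun x => (∫ t, |Real.log t| ∂expLaw) + |Real.log (f x)|)
    (fun n => (hint n).aestronglyMeasurable) ((integrable_const _).add hlog.abs) (fun n => ?_) ?_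
  · filter_upwards [ae_law_pos hf] with x hx
    rw [hclamp n x hx]
    refine (norm_integral_le_integral_norm _).trans ?_
    have : (∫ t, |Real.log t| ∂expLaw) + |Real.log (f x)|
        = ∫ t, (|Real.log t| + |Real.log (f x)|) ∂expLaw := by
      rw [integral_add integrable_log_expLaw.abs (integrable_const _)]
      simp
    rw [this]
    refine integral_mono (integrable_clamp_log_sub n.cast_nonneg _).norm
      (integrable_log_expLaw.abs.add (integrable_const _)) fun t => ?_
    exact (abs_clamp_le n.cast_nonneg _).trans (abs_sub _ _)
  · filter_upwards [ae_law_pos hf] with x hx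
    simp_rw [hclamp _ x hx]
    have : -Real.eulerMascheroniConstant - Real.log (f x)
        = ∫ t, (Real.log t - Real.log (f x)) ∂expLaw := by
      rw [integral_sub integrable_log_expLaw (integrable_const _), integral_log_expLaw]
      simp
    rw [this]
    exact tendsto_integral_of_dominated_convergence
      (fun t => |Real.log t - Real.log (f x)|)
      (fun n => (integrable_clamp_log_sub n.cast_nonneg _).aestronglyMeasurable)
      (integrable_log_expLaw.sub (integrable_const _)).abs
      (fun n => ae_of_all _ fun t => abs_clamp_le n.cast_nonneg _)
      (ae_of_all _ fun t => tendsto_clamp _)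

/-! ### Mean-square convergence of the truncated estimator -/

/-- Expanding the square, the `m + 2` diagonal terms contribute `p` each and the `(m + 2)(m + 1)`
others `q` each. The value tends to `0` when `p → c` and `q → c²`. -/
lemma integral_sq_mean_indicator_sub {Ω : Type*} [MeasurableSpace Ω] {P : Measure Ω}
    [IsProbabilityMeasure P] {m : ℕ} {S : Fin (m + 2) → Set Ω} (hS : ∀ i, MeasurableSet (S i))
    {p q : ℝ} (hp : ∀ i, P.real (S i) = p) (hq : ∀ i j, j ≠ i → P.real (S i ∩ S j) = q) (c : ℝ) :
    ∫ ω, ((∑ i, (S i).indicator (fun _ => (1 : ℝ)) ω) / (m + 2) - c) ^ 2 ∂P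
      = p / (m + 2) + (m + 1) / (m + 2) * q - 2 * c * p + c ^ 2 := by
  have hint : ∀ T : Set Ω, MeasurableSet T → Integrable (T.indicator fun _ => (1 : ℝ)) P :=
    fun T hT => (integrable_const 1).indicator hT
  have hexp : ∀ ω, ((∑ i, (S i).indicator (fun _ => (1 : ℝ)) ω) / (m + 2) - c) ^ 2
      = (1 / (m + 2) ^ 2) * ∑ i, ∑ j, (S i ∩ S j).indicator (fun _ => (1 : ℝ)) ω
        - (2 * c / (m + 2)) * ∑ i, (S i).indicator (fun _ => (1 : ℝ)) ω + c ^ 2 := fun ω => by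
    have : ∑ i, ∑ j, (S i ∩ S j).indicator (fun _ => (1 : ℝ)) ω
        = (∑ i, (S i).indicator (fun _ => (1 : ℝ)) ω) ^ 2 := by
      rw [sq, Finset.sum_mul_sum]
      refine Finset.sum_congr rfl fun i _ => Finset.sum_congr rfl fun j _ => ?_
      by_cases hi : ω ∈ S i <;> by_cases hj : ω ∈ S j <;> simp [hi, hj]
    rw [this]
    field_simp
    ring
  have h1 : ∫ ω, ∑ i, (S i).indicator (fun _ => (1 : ℝ)) ω ∂P = (m + 2) * p := by
    rw [integral_finsetSum _ fun i _ => hint _ (hS i)]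
    simp [integral_indicator_const _ (hS _), hp]
  have h2 : ∫ ω, ∑ i, ∑ j, (S i ∩ S j).indicator (fun _ => (1 : ℝ)) ω ∂P
      = (m + 2) * (p + (m + 1) * q) := by
    rw [integral_finsetSum _ fun i _ => integrable_finsetSum _ fun j _ =>
      hint _ ((hS i).inter (hS j))]
    have : ∀ i, ∫ ω, ∑ j, (S i ∩ S j).indicator (fun _ => (1 : ℝ)) ω ∂P = p + (m + 1) * q := by
      intro i
      rw [integral_finsetSum _ fun j _ => hint _ ((hS i).inter (hS j))]
      simp only [integral_indicator_const _ ((hS i).inter (hS _)), smul_eq_mul, mul_one]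
      rw [← Finset.add_sum_erase _ _ (Finset.mem_univ i), Set.inter_self, hp,
        Finset.sum_congr rfl fun j hj => hq i j (Finset.ne_of_mem_erase hj)]
      simp
    simp [this, -mul_eq_mul_left_iff]
    ring
  have i1 : Integrable (fun ω => ∑ i, (S i).indicator (fun _ => (1 : ℝ)) ω) P :=
    integrable_finsetSum _ fun i _ => hint _ (hS i)
  have i2 : Integrable (fun ω => ∑ i, ∑ j, (S i ∩ S j).indicator (fun _ => (1 : ℝ)) ω) P :=
    integrable_finsetSum _ fun i _ => integrable_finsetSum _ fun j _ =>
      hint _ ((hS i).inter (hS j))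
  have i3 : Integrable (fun ω =>
      (1 / ((m : ℝ) + 2) ^ 2) * ∑ i, ∑ j, (S i ∩ S j).indicator (fun _ => (1 : ℝ)) ω
        - (2 * c / (m + 2)) * ∑ i, (S i).indicator (fun _ => (1 : ℝ)) ω) P :=
    (i2.const_mul _).sub (i1.const_mul _)
  simp_rw [hexp]
  rw [integral_add i3 (integrable_const _),
    integral_sub (i2.const_mul _) (i1.const_mul _), integral_const_mul, integral_const_mul, h1, h2]
  simp only [integral_const, probReal_univ, one_smul]
  field_simp

/-- The proportion of sample points whose normalized logarithmic volume exceeds `s`. -/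
def empSurvival {m : ℕ} (x : Fin (m + 2) → EuclideanSpace ℝ (Fin d)) (s : ℝ) : ℝ :=
  (∑ i, (Set.Iio (logVol d m (nnDist x i))).indicator (fun _ => (1 : ℝ)) s) / (m + 2)

lemma measurable_empSurvival (m : ℕ) :
    Measurable fun p : (Fin (m + 2) → EuclideanSpace ℝ (Fin d)) × ℝ => empSurvival p.1 p.2 := by
  refine (Finset.measurable_fun_sum _ fun i _ => ?_).div_const _
  have : MeasurableSet {p : (Fin (m + 2) → EuclideanSpace ℝ (Fin d)) × ℝ |
      p.2 < logVol d m (nnDist p.1 i)} := measurableSet_lt measurable_snd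
    ((measurable_logVol d m).comp ((measurable_nnDist i).comp measurable_fst))
  exact (measurable_const (a := (1 : ℝ))).indicator this

lemma empSurvival_mem_Icc {m : ℕ} (x : Fin (m + 2) → EuclideanSpace ℝ (Fin d)) (s : ℝ) :
    empSurvival x s ∈ Set.Icc (0 : ℝ) 1 := by
  have h0 : ∀ i : Fin (m + 2), 0 ≤ (Set.Iio (logVol d m (nnDist x i))).indicator
      (fun _ => (1 : ℝ)) s := fun i => Set.indicator_nonneg (fun _ _ => zero_le_one) _
  have h1 : ∀ i : Fin (m + 2), (Set.Iio (logVol d m (nnDist x i))).indicator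
      (fun _ => (1 : ℝ)) s ≤ 1 := fun i => Set.indicator_le_self' (fun _ _ => zero_le_one) _
  refine ⟨div_nonneg (Finset.sum_nonneg fun i _ => h0 i) (by positivity), ?_⟩
  rw [empSurvival, div_le_one (by positivity)]
  exact (Finset.sum_le_sum fun i _ => h1 i).trans_eq (by simp)

lemma measurable_limitSurvival {f : EuclideanSpace ℝ (Fin d) → ℝ} (hf0 : ∀ x, 0 ≤ f x) :
    Measurable (limitSurvival f) := by
  refine Antitone.measurable fun s t hst => lintegral_mono fun x => ENNReal.ofReal_le_ofReal ?_
  rw [Real.exp_le_exp, neg_le_neg_iff]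
  exact mul_le_mul_of_nonneg_right (Real.exp_le_exp.2 hst) (hf0 x)

lemma sq_empSurvival_sub_le_one {f : EuclideanSpace ℝ (Fin d) → ℝ} (hf0 : ∀ x, 0 ≤ f x)
    [IsProbabilityMeasure (law f)] {m : ℕ} (x : Fin (m + 2) → EuclideanSpace ℝ (Fin d)) (s : ℝ) :
    (empSurvival x s - (limitSurvival f s).toReal) ^ 2 ≤ 1 := by
  obtain ⟨h0, h1⟩ := empSurvival_mem_Icc x s
  have h2 : (limitSurvival f s).toReal ≤ 1 :=
    ENNReal.toReal_le_of_le_ofReal zero_le_one (by simpa using limitSurvival_le_one hf0 s)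
  have h3 : 0 ≤ (limitSurvival f s).toReal := ENNReal.toReal_nonneg
  rw [sq_le_one_iff_abs_le_one, abs_le]
  constructor <;> linarith

/-- A weak law of large numbers for dependent indicators: `p → c` is the one-point limit, and `q →
c²` the asymptotic independence of two points. -/
lemma tendsto_sq_empSurvival_sub (hd : 0 < d) {f : EuclideanSpace ℝ (Fin d) → ℝ}
    (hf : AEMeasurable f volume) (hf0 : ∀ x, 0 ≤ f x) [IsProbabilityMeasure (law f)] (s : ℝ) :
    Tendsto (fun m => ∫⁻ x, ENNReal.ofReal ((empSurvival x s - (limitSurvival f s).toReal) ^ 2)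
      ∂Measure.pi (fun _ : Fin (m + 2) => law f)) atTop (𝓝 0) := by
  set c := (limitSurvival f s).toReal with hc
  have hne : limitSurvival f s ≠ ∞ := ne_top_of_le_ne_top ENNReal.one_ne_top
    (limitSurvival_le_one hf0 s)
  set S : ∀ m : ℕ, Fin (m + 2) → Set (Fin (m + 2) → EuclideanSpace ℝ (Fin d)) :=
    fun m i => {x | radius d m s < nnDist x i} with hSdef
  have hS : ∀ m i, MeasurableSet (S m i) := fun m i =>
    measurableSet_lt measurable_const (measurable_nnDist i)
  set p : ℕ → ℝ := fun m => (Measure.pi (fun _ : Fin (m + 2) => law f)).real (S m 0)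
  set q : ℕ → ℝ := fun m => (Measure.pi (fun _ : Fin (m + 2) => law f)).real (S m 0 ∩ S m 1)
  have hp : Tendsto p atTop (𝓝 c) :=
    (ENNReal.tendsto_toReal hne).comp (tendsto_measure_lt_nnDist hd hf hf0 s)
  have hq : Tendsto q atTop (𝓝 (c ^ 2)) := by
    have := (ENNReal.tendsto_toReal (ENNReal.pow_ne_top hne)).comp
      (tendsto_measure_lt_nnDist_pair hd hf hf0 s)
    rwa [ENNReal.toReal_pow] at this
  have heq : ∀ m : ℕ, ∫⁻ x, ENNReal.ofReal ((empSurvival x s - c) ^ 2)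
      ∂Measure.pi (fun _ : Fin (m + 2) => law f)
      = ENNReal.ofReal (p m / (m + 2) + (m + 1) / (m + 2) * q m - 2 * c * p m + c ^ 2) := by
    intro m
    rw [← integral_sq_mean_indicator_sub (P := Measure.pi (fun _ : Fin (m + 2) => law f)) (hS m)
      (p := p m) (q := q m) ?_ ?_ c, ofReal_integral_eq_lintegral_ofReal]
    · refine lintegral_congr_ae ?_
      filter_upwards [ae_nnDist_pos hd (f := f) m] with x hx
      have : empSurvival x s = (∑ i, (S m i).indicator (fun _ => (1 : ℝ)) x) / (m + 2) := by
        unfold empSurvival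
        congr 1
        refine Finset.sum_congr rfl fun i _ => ?_
        simp only [Set.indicator_apply, Set.mem_Iio, lt_logVol_iff hd m s (hx i)]
        rfl
      rw [this]
    · refine Integrable.of_bound (C := (1 + |c|) ^ 2) ?_ (ae_of_all _ fun x => ?_)
      · exact (((Finset.measurable_fun_sum _ fun i _ =>
          measurable_const.indicator (hS m i)).div_const _).sub_const _).pow_const 2
          |>.aestronglyMeasurable
      · rw [norm_pow, Real.norm_eq_abs]
        refine pow_le_pow_left₀ (abs_nonneg _) ((abs_sub _ _).trans ?_) 2
        gcongr
        rw [abs_of_nonneg (div_nonneg (Finset.sum_nonneg fun i _ =>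
          Set.indicator_nonneg (fun _ _ => zero_le_one) _) (by positivity)),
          div_le_one (by positivity)]
        exact (Finset.sum_le_sum fun i _ => Set.indicator_le_self'
          (fun _ _ => zero_le_one) _).trans_eq (by simp)
    · exact ae_of_all _ fun x => sq_nonneg _
    · intro i
      simp only [p, measureReal_def, S, pi_lt_nnDist]
    · intro i j hij
      have h1 := pi_lt_nnDist_pair (law f) m hij (radius d m s)
      have h2 := pi_lt_nnDist_pair (law f) m (i := 0) (j := 1) (by simp) (radius d m s)
      exact congrArg ENNReal.toReal (h1.trans h2.symm)
  simp_rw [heq]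
  have hm1 : Tendsto (fun m : ℕ => (1 : ℝ) / ((m : ℝ) + 2)) atTop (𝓝 0) :=
    tendsto_const_nhds.div_atTop
      (tendsto_atTop_add_const_right _ _ tendsto_natCast_atTop_atTop)
  have hlim := (((hp.mul hm1).add ((tendsto_const_nhds (x := (1 : ℝ)).sub hm1).mul hq)).sub
    (hp.const_mul (2 * c))).add_const (c ^ 2)
  have hz : c * 0 + (1 - 0) * c ^ 2 - 2 * c * c + c ^ 2 = 0 := by ring
  rw [hz] at hlim
  have := ENNReal.tendsto_ofReal hlim
  rw [ENNReal.ofReal_zero] at this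
  refine this.congr fun m => ?_
  congr 1
  field_simp
  ring

/-- Cauchy–Schwarz against the constant `1`, from `∫ (L g - I)² ≥ 0`; dividing by `L` requires the
zero measure to be treated apart. -/
lemma sq_integral_le {α : Type*} [MeasurableSpace α] {κ : Measure α} [IsFiniteMeasure κ]
    {g : α → ℝ} (hg : MemLp g 2 κ) : (∫ s, g s ∂κ) ^ 2 ≤ κ.real Set.univ * ∫ s, g s ^ 2 ∂κ := by
  have hg1 : Integrable g κ := hg.integrable one_le_two
  have hg2 : Integrable (fun s => g s ^ 2) κ := hg.integrable_sq
  set L := κ.real Set.univ with hL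
  set I := ∫ s, g s ∂κ with hI
  have hL0 : 0 ≤ L := measureReal_nonneg
  have h : 0 ≤ ∫ s, (L * g s - I) ^ 2 ∂κ := integral_nonneg fun s => sq_nonneg _
  have he : ∀ s, (L * g s - I) ^ 2 = L ^ 2 * g s ^ 2 - 2 * L * I * g s + I ^ 2 := fun s => by ring
  have hi : Integrable (fun s => L ^ 2 * g s ^ 2 - 2 * L * I * g s) κ :=
    (hg2.const_mul _).sub (hg1.const_mul _)
  simp_rw [he] at h
  rw [integral_add hi (integrable_const _),
    integral_sub (hg2.const_mul _) (hg1.const_mul _), integral_const_mul, integral_const_mul,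
    integral_const, ← hI, ← hL, smul_eq_mul] at h
  rcases hL0.eq_or_lt with h0 | h0
  · have : κ = 0 := by
      rw [← Measure.measure_univ_eq_zero]
      exact (measureReal_eq_zero_iff).1 (hL ▸ h0.symm)
    simp [hI, this]
  · have hLI : 0 ≤ L * (L * (∫ s, g s ^ 2 ∂κ) - I ^ 2) := by nlinarith
    nlinarith [nonneg_of_mul_nonneg_right hLI h0]

/-- The truncated estimator converges in mean square. -/
lemma tendsto_sq_mean_clamp_sub (hd : 0 < d) {f : EuclideanSpace ℝ (Fin d) → ℝ}
    (hf : AEMeasurable f volume) (hf0 : ∀ x, 0 ≤ f x) [IsProbabilityMeasure (law f)] {A : ℝ}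
    (hA : 0 ≤ A) :
    Tendsto (fun m => ∫⁻ x, ENNReal.ofReal
      (((∑ i, clamp A (logVol d m (nnDist x i))) / (m + 2) - truncMean f A) ^ 2)
      ∂Measure.pi (fun _ : Fin (m + 2) => law f)) atTop (𝓝 0) := by
  set κ := (volume : Measure ℝ).restrict (Set.Ioc (-A) A) with hκ
  have hmeasF : ∀ m : ℕ, Measurable fun p : (Fin (m + 2) → EuclideanSpace ℝ (Fin d)) × ℝ =>
      ENNReal.ofReal ((empSurvival p.1 p.2 - (limitSurvival f p.2).toReal) ^ 2) := fun m =>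
    (((measurable_empSurvival m).sub ((measurable_limitSurvival hf0).comp
      measurable_snd).ennreal_toReal).pow_const 2).ennreal_ofReal
  -- By the layer cake the deviation is the integral of `empSurvival - limitSurvival` over `(-A,
  -- A]`, the two shifts by `A` cancelling; Cauchy–Schwarz then costs the length `2A`.
  have hbound : ∀ m (x : Fin (m + 2) → EuclideanSpace ℝ (Fin d)), ENNReal.ofReal
      (((∑ i, clamp A (logVol d m (nnDist x i))) / (m + 2) - truncMean f A) ^ 2)
      ≤ ENNReal.ofReal (2 * A) * ∫⁻ s, ENNReal.ofReal
        ((empSurvival x s - (limitSurvival f s).toReal) ^ 2) ∂κ := by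
    intro m x
    have hmF : Measurable fun s => empSurvival x s - (limitSurvival f s).toReal :=
      ((measurable_empSurvival m).comp measurable_prodMk_left).sub
        (measurable_limitSurvival hf0).ennreal_toReal
    have hL2 : MemLp (fun s => empSurvival x s - (limitSurvival f s).toReal) 2 κ := by
      refine MemLp.of_bound hmF.aestronglyMeasurable 1 (ae_of_all _ fun s => ?_)
      rw [Real.norm_eq_abs, ← sq_le_one_iff_abs_le_one]
      exact sq_empSurvival_sub_le_one hf0 x s
    have hiE : Integrable (fun s => empSurvival x s) κ := by
      refine Integrable.of_bound (C := 1) ((measurable_empSurvival m).comp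
        measurable_prodMk_left).aestronglyMeasurable (ae_of_all _ fun s => ?_)
      rw [Real.norm_of_nonneg (empSurvival_mem_Icc x s).1]
      exact (empSurvival_mem_Icc x s).2
    have hiF : Integrable (fun s => (limitSurvival f s).toReal) κ := by
      have := hiE.sub (hL2.integrable one_le_two)
      refine this.congr (ae_of_all _ fun s => ?_)
      simp
    have hE : ∫ s, empSurvival x s ∂κ
        = (∑ i, clamp A (logVol d m (nnDist x i))) / (m + 2) + A := by
      simp only [empSurvival]
      rw [integral_div, integral_finsetSum _ fun i _ =>
        (integrable_const (1 : ℝ)).indicator measurableSet_Iio]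
      simp_rw [hκ, setIntegral_indicator_Iio]
      rw [Finset.sum_add_distrib]
      simp
      field_simp
    have hdiff : (∑ i, clamp A (logVol d m (nnDist x i))) / (m + 2) - truncMean f A
        = ∫ s, (empSurvival x s - (limitSurvival f s).toReal) ∂κ := by
      rw [integral_sub hiE hiF, hE, truncMean]
      ring
    have hLen : κ.real Set.univ = 2 * A := by
      rw [hκ, measureReal_restrict_apply_univ, Real.volume_real_Ioc_of_le (by linarith)]
      ring
    rw [hdiff, ← ofReal_integral_eq_lintegral_ofReal hL2.integrable_sq
      (ae_of_all _ fun s => sq_nonneg _), ← ENNReal.ofReal_mul (by positivity)]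
    exact ENNReal.ofReal_le_ofReal (hLen ▸ sq_integral_le hL2)
  have hlim : Tendsto (fun m : ℕ => ENNReal.ofReal (2 * A) * ∫⁻ s, ∫⁻ x, ENNReal.ofReal
        ((empSurvival x s - (limitSurvival f s).toReal) ^ 2)
        ∂Measure.pi (fun _ : Fin (m + 2) => law f) ∂κ) atTop (𝓝 0) := by
    have h : Tendsto (fun m : ℕ => ∫⁻ s, ∫⁻ x, ENNReal.ofReal
        ((empSurvival x s - (limitSurvival f s).toReal) ^ 2)
        ∂Measure.pi (fun _ : Fin (m + 2) => law f) ∂κ) atTop (𝓝 (∫⁻ _, 0 ∂κ)) := by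
      refine tendsto_lintegral_of_dominated_convergence (fun _ => 1)
        (fun m => (hmeasF m).lintegral_prod_left') (fun m => ae_of_all _ fun s => ?_) ?_
        (ae_of_all _ fun s => tendsto_sq_empSurvival_sub hd hf hf0 s)
      · refine (lintegral_mono (g := 1) fun x => ?_).trans_eq (by simp)
        rw [Pi.one_apply, ENNReal.ofReal_le_one]
        exact sq_empSurvival_sub_le_one hf0 x s
      · rw [lintegral_one]
        exact measure_ne_top _ _
    rw [lintegral_zero] at h
    have h' := ENNReal.Tendsto.const_mul h
      (Or.inr (ENNReal.ofReal_ne_top (r := 2 * A)))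
    rwa [mul_zero] at h'
  refine tendsto_of_tendsto_of_tendsto_of_le_of_le tendsto_const_nhds hlim (fun m => zero_le)
    fun m => ?_
  refine (lintegral_mono (hbound m)).trans_eq ?_
  rw [lintegral_const_mul' _ _ ENNReal.ofReal_ne_top, lintegral_lintegral_swap]
  exact (hmeasF m).aemeasurable

/-! ### Truncation errors -/

/-- The constant `2 ∫ t exp (-ε t) dt` of the truncation error. -/
def expTailConst (ε : ℝ) : ℝ≥0∞ :=
  ENNReal.ofReal 2 * ∫⁻ t in Set.Ioi (0 : ℝ), ENNReal.ofReal (Real.exp (-(ε * t)) * t)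

lemma expTailConst_ne_top {ε : ℝ} (hε : 0 < ε) : expTailConst ε ≠ ∞ := by
  have h := integrableOn_rpow_mul_exp_neg_mul_rpow (s := 1) (p := 1) (by norm_num) one_pos hε
  refine ENNReal.mul_ne_top ENNReal.ofReal_ne_top ?_
  have h' : IntegrableOn (fun t : ℝ => Real.exp (-(ε * t)) * t) (Set.Ioi 0) := by
    refine h.congr_fun (fun t _ => ?_) measurableSet_Ioi
    simp only [Real.rpow_one, neg_mul]
    ring
  refine ne_top_of_le_ne_top h'.2.ne (lintegral_mono fun t => ?_)
  exact Real.ofReal_le_enorm _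

/-- `E (Y - A)₊² = 2 ∫ t P(Y > A + t) dt`; the tail bound at `A + t` splits off `e^{-εA}`, making
the error small uniformly in the sample size. -/
lemma lintegral_sq_excess_le {Ω : Type*} [MeasurableSpace Ω] {P : Measure Ω} {Y : Ω → ℝ}
    (hY : Measurable Y) {C : ℝ≥0∞} {ε : ℝ}
    (h : ∀ s, 0 ≤ s → P {ω | s < Y ω} ≤ C * ENNReal.ofReal (Real.exp (-(ε * s)))) {A : ℝ}
    (hA : 0 ≤ A) (hC : C ≠ ∞) :
    ∫⁻ ω, ENNReal.ofReal (max (Y ω - A) 0 ^ 2) ∂P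
      ≤ C * ENNReal.ofReal (Real.exp (-(ε * A))) * expTailConst ε := by
  have hlc := lintegral_rpow_eq_lintegral_meas_lt_mul P (f := fun ω => max (Y ω - A) 0)
    (ae_of_all _ fun ω => le_max_right _ _) ((hY.sub_const A).max measurable_const).aemeasurable
    (p := 2) two_pos
  simp only [Real.rpow_two] at hlc
  rw [hlc, expTailConst, mul_left_comm]
  refine mul_le_mul_right ?_ _
  rw [← lintegral_const_mul' _ _ (ENNReal.mul_ne_top hC ENNReal.ofReal_ne_top)]
  refine setLIntegral_mono' measurableSet_Ioi fun t ht => ?_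
  have ht' : (0 : ℝ) < t := ht
  have hset : {ω | t < max (Y ω - A) 0} = {ω | A + t < Y ω} := by
    ext ω
    simp only [Set.mem_ofPred_eq, lt_max_iff, not_lt.2 ht'.le, or_false]
    constructor <;> intro h <;> linarith
  rw [hset]
  refine (mul_le_mul_left (h _ (by linarith)) _).trans_eq ?_
  rw [mul_assoc, mul_assoc, ← ENNReal.ofReal_mul (Real.exp_pos _).le,
    ← ENNReal.ofReal_mul (Real.exp_pos _).le, ← mul_assoc (Real.exp _), ← Real.exp_add]
  congr 3
  · ring_nf
  · norm_num

lemma measure_lt_abs_logVol_le (hd : 0 < d) {f : EuclideanSpace ℝ (Fin d) → ℝ}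
    [IsProbabilityMeasure (law f)] {ε R : ℝ} (hε : 0 < ε) (hε1 : ε ≤ 1) (hR : 0 < R) {m : ℕ}
    (hm : 1 ≤ ((m : ℝ) + 1) * (R ^ d * unitBallVol d)) (i : Fin (m + 2)) {s : ℝ} (hs : 0 ≤ s) :
    (Measure.pi (fun _ : Fin (m + 2) => law f)).restrict {x | nnDist x i ≤ R}
        {x | s < |logVol d m (nnDist x i)|}
      ≤ (∫⁻ x, minAvg f x R ^ (-ε) ∂law f + ∫⁻ x, maxAvg f x R ^ ε ∂law f)
        * ENNReal.ofReal (Real.exp (-(ε * s))) := by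
  set ν := Measure.pi (fun _ : Fin (m + 2) => law f)
  have hexp1 : ENNReal.ofReal (Real.exp s) ^ (-ε) = ENNReal.ofReal (Real.exp (-(ε * s))) := by
    rw [ENNReal.ofReal_rpow_of_pos (Real.exp_pos _), ← Real.exp_mul]
    ring_nf
  have hexp2 : ENNReal.ofReal (Real.exp (-s)) ^ ε = ENNReal.ofReal (Real.exp (-(ε * s))) := by
    rw [ENNReal.ofReal_rpow_of_pos (Real.exp_pos _), ← Real.exp_mul]
    ring_nf
  have h1 : ν {x | radius d m s < nnDist x i ∧ nnDist x i ≤ R}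
      ≤ (∫⁻ x, minAvg f x R ^ (-ε) ∂law f) * ENNReal.ofReal (Real.exp (-(ε * s))) := by
    -- Averages are controlled only up to radius `R`; for larger `s` the restriction to `nnDist x i
    -- ≤ R` leaves nothing.
    by_cases h : radius d m s ≤ R
    · refine (measure_mono fun x hx => hx.1).trans
        ((measure_lt_nnDist_le hε hε1 (radius_pos d m s) h m i).trans_eq ?_)
      rw [radius_pow hd, hexp1, mul_comm]
    · have : {x : Fin (m + 2) → EuclideanSpace ℝ (Fin d) |
          radius d m s < nnDist x i ∧ nnDist x i ≤ R} = ∅ := by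
        ext x
        simp only [Set.mem_ofPred_eq, Set.mem_empty_iff_false, iff_false, not_and, not_le]
        exact fun hx => (not_le.1 h).trans hx
      rw [this, measure_empty]
      exact zero_le
  have h2 : ν {x | nnDist x i ≤ radius d m (-s)}
      ≤ (∫⁻ x, maxAvg f x R ^ ε ∂law f) * ENNReal.ofReal (Real.exp (-(ε * s))) := by
    -- For the lower tail the radius never exceeds `R`: by `hm` the ball of radius `R` has volume at
    -- least `1 / (m + 1)`.
    have h : radius d m (-s) ≤ R := by
      rw [radius_le_iff hd m _ hR]
      exact (Real.exp_le_one_iff.2 (by linarith)).trans hm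
    refine (measure_nnDist_le_le hε hε1 (radius_pos d m _) h m i).trans_eq ?_
    rw [radius_pow hd, hexp2, mul_comm]
  have hmeas : MeasurableSet {x : Fin (m + 2) → EuclideanSpace ℝ (Fin d) |
      s < |logVol d m (nnDist x i)|} := measurableSet_lt measurable_const
    (((measurable_logVol d m).comp (measurable_nnDist i)).abs)
  rw [Measure.restrict_apply hmeas, add_mul]
  refine le_trans ?_ (add_le_add h1 h2)
  refine le_trans (measure_mono_ae ?_) (measure_union_le _ _)
  filter_upwards [ae_nnDist_pos hd (f := f) m] with x hx
  rintro ⟨hx1, hx2⟩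
  have hx1' : s < |logVol d m (nnDist x i)| := hx1
  rcases lt_abs.1 hx1' with h | h
  · exact Or.inl ⟨(lt_logVol_iff hd m s (hx i)).1 h, hx2⟩
  · refine Or.inr (show nnDist x i ≤ radius d m (-s) from not_lt.1 fun h' => ?_)
    have := (lt_logVol_iff hd m (-s) (hx i)).2 h'
    linarith

lemma le_exp_add_G {t : ℝ} (ht : 0 ≤ t) : t ≤ Real.exp 1 + G t := by
  unfold G
  split_ifs with h
  · linarith [Real.add_one_le_exp (1 : ℝ)]
  · rw [not_lt] at h
    rcases le_total t (Real.exp 1) with h' | h'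
    · linarith [mul_nonneg ht (Real.log_nonneg h)]
    · have : 1 ≤ Real.log t := (Real.le_log_iff_exp_le (by linarith)).2 h'
      nlinarith [Real.exp_pos 1]

/-- The only use of `K₂`: since `t ≤ e + G t` and `u ≤ 1 + u^(1+ε)`, it makes `log² |X - Y|`
integrable for independent `X`, `Y`. -/
lemma lintegral_sq_log_dist_lt_top (hd : 0 < d) {f : EuclideanSpace ℝ (Fin d) → ℝ}
    (hf : AEMeasurable f volume) [IsProbabilityMeasure (law f)] {ε : ℝ} (hε : 0 < ε)
    (hK : K₂ f ε < ∞) :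
    ∫⁻ x, ∫⁻ y, ENNReal.ofReal (Real.log (dist x y) ^ 2) ∂law f ∂law f < ∞ := by
  have : Nonempty (Fin d) := ⟨⟨0, hd⟩⟩
  have hinner : ∀ x : EuclideanSpace ℝ (Fin d),
      ∫⁻ y, ENNReal.ofReal (Real.log (dist x y) ^ 2) ∂law f
        ≤ (ENNReal.ofReal (Real.exp 1) + 1) + (∫⁻ y in {x}ᶜ,
          ENNReal.ofReal (G (Real.log (dist x y) ^ 2)) * ENNReal.ofReal (f y)) ^ (1 + ε) := by
    intro x
    have hres : (volume : Measure (EuclideanSpace ℝ (Fin d))).restrict {x}ᶜ = volume :=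
      Measure.restrict_eq_self_of_ae_mem (measure_eq_zero_iff_ae_notMem.1 (measure_singleton x))
    rw [hres, ← lintegral_law hf]
    calc ∫⁻ y, ENNReal.ofReal (Real.log (dist x y) ^ 2) ∂law f
        ≤ ∫⁻ y, ENNReal.ofReal (Real.exp 1)
          + ENNReal.ofReal (G (Real.log (dist x y) ^ 2)) ∂law f := by
          refine lintegral_mono fun y => ?_
          exact (ENNReal.ofReal_le_ofReal (le_exp_add_G (sq_nonneg _))).trans
            ENNReal.ofReal_add_le
      _ = ENNReal.ofReal (Real.exp 1)
          + ∫⁻ y, ENNReal.ofReal (G (Real.log (dist x y) ^ 2)) ∂law f := by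
          rw [lintegral_add_left measurable_const]
          simp
      _ ≤ _ := by
          rw [add_assoc]
          gcongr
          conv_lhs => rw [← ENNReal.rpow_one (∫⁻ y, _ ∂law f)]
          exact rpow_le_one_add_rpow _ zero_le_one (by linarith)
  refine (lintegral_mono hinner).trans_lt ?_
  rw [lintegral_add_left measurable_const, lintegral_law hf]
  refine ENNReal.add_lt_top.2 ⟨?_, ?_⟩
  · rw [← lintegral_law hf, lintegral_const, measure_univ, mul_one]
    exact ENNReal.add_lt_top.2 ⟨ENNReal.ofReal_lt_top, ENNReal.one_lt_top⟩
  · rw [lintegral_law hf]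
    exact hK

/-- Here `ρ` will be the nearest-neighbour distance and `D` the distance to one fixed other point,
whose law does not change with `m`. -/
lemma sq_logVol_le {R ρ D : ℝ} (hR : 0 < R) (hRρ : R < ρ) (hρD : ρ ≤ D)
    (d m : ℕ) : logVol d m ρ ^ 2
      ≤ 2 * (Real.log ((m : ℝ) + 1) + (|Real.log (unitBallVol d)| + d * |Real.log R|)) ^ 2
        + 2 * (d : ℝ) ^ 2 * Real.log D ^ 2 := by
  have hρ : 0 < ρ := hR.trans hRρ
  have hV := unitBallVol_pos d
  have hlog : |Real.log ρ| ≤ |Real.log R| + |Real.log D| := by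
    have h1 := Real.log_le_log hR hRρ.le
    have h2 := Real.log_le_log hρ hρD
    have h3 := neg_abs_le (Real.log R)
    have h4 := le_abs_self (Real.log D)
    have h5 := abs_nonneg (Real.log R)
    have h6 := abs_nonneg (Real.log D)
    rw [abs_le]
    constructor <;> linarith
  have hm : 0 ≤ Real.log ((m : ℝ) + 1) := Real.log_nonneg (by simp)
  have hexp : logVol d m ρ = Real.log ((m : ℝ) + 1) + (d * Real.log ρ + Real.log (unitBallVol d)) := by
    rw [logVol, Real.log_mul (by positivity) (by positivity), Real.log_mul (by positivity) hV.ne',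
      Real.log_pow]
  set a := Real.log ((m : ℝ) + 1) + (|Real.log (unitBallVol d)| + d * |Real.log R|) with ha
  have hd0 : (0 : ℝ) ≤ d := d.cast_nonneg
  have habs : |logVol d m ρ| ≤ a + d * |Real.log D| := by
    rw [hexp]
    refine (abs_add_le _ _).trans ?_
    rw [abs_of_nonneg hm, ha]
    have := abs_add_le (d * Real.log ρ) (Real.log (unitBallVol d))
    rw [abs_mul, abs_of_nonneg hd0] at this
    nlinarith [mul_le_mul_of_nonneg_left hlog hd0]
  calc logVol d m ρ ^ 2 = |logVol d m ρ| ^ 2 := (sq_abs _).symm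
    _ ≤ (a + d * |Real.log D|) ^ 2 := pow_le_pow_left₀ (abs_nonneg _) habs 2
    _ ≤ 2 * (a ^ 2 + (d * |Real.log D|) ^ 2) := add_sq_le
    _ = _ := by
      rw [mul_pow, sq_abs]
      ring

lemma tendsto_sq_log_mul_rpow_neg {ε v : ℝ} (hε : 0 < ε) (hv : 0 < v) (B : ℝ) :
    Tendsto (fun m : ℕ => 2 * (Real.log ((m : ℝ) + 1) + B) ^ 2 * (((m : ℝ) + 1) * v) ^ (-ε)) atTop
      (𝓝 0) := by
  have hlog : Tendsto (fun m : ℕ => ε * (Real.log ((m : ℝ) + 1) + B)) atTop atTop :=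
    (tendsto_atTop_add_const_right _ _ (Real.tendsto_log_atTop.comp
      (tendsto_atTop_add_const_right _ _ tendsto_natCast_atTop_atTop))).const_mul_atTop hε
  -- With `u = ε (log (m + 1) + B)`, `(m + 1)^{-ε} = e^{εB} e^{-u}`, so the sequence is this
  -- constant times `u² e^{-u}`.
  have h := ((Real.tendsto_pow_mul_exp_neg_atTop_nhds_zero 2).comp hlog).const_mul
    (2 / ε ^ 2 * v ^ (-ε) * Real.exp (ε * B))
  rw [mul_zero] at h
  refine h.congr fun m => ?_
  have hm : (0 : ℝ) < (m : ℝ) + 1 := by positivity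
  have he : ((m : ℝ) + 1) ^ (-ε)
      = Real.exp (ε * B) * Real.exp (-(ε * (Real.log ((m : ℝ) + 1) + B))) := by
    rw [Real.rpow_def_of_pos hm, ← Real.exp_add]
    congr 1
    ring
  rw [Real.mul_rpow hm.le hv.le, he]
  simp only [Function.comp_apply]
  field_simp

/-- Sample points without a neighbour within distance `R` do not contribute to the second moment
in the limit. -/
lemma tendsto_lintegral_sq_logVol_far {Ω : Type*} [MeasurableSpace Ω] {P : Measure Ω}
    [IsProbabilityMeasure P] (hd : 0 < d) {f : EuclideanSpace ℝ (Fin d) → ℝ}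
    (hf : AEMeasurable f volume) [IsProbabilityMeasure (law f)]
    {X : ℕ → Ω → EuclideanSpace ℝ (Fin d)} (hX : ∀ i, Measurable (X i))
    (hindep : iIndepFun X P) (hdens : ∀ i, P.map (X i) = law f)
    (hlaw : ∀ m : ℕ, P.map (fun ω (i : Fin (m + 2)) => X i ω)
      = Measure.pi fun _ : Fin (m + 2) => law f) {ε δ R : ℝ} (hδ : 0 < δ)
    (hK : K₂ f δ < ∞) (hε : 0 < ε) (hε1 : ε ≤ 1) (hR : 0 < R)
    (hT : ∫⁻ x, minAvg f x R ^ (-ε) ∂law f < ∞) :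
    Tendsto (fun m => ∫⁻ x in {x | R < nnDist x 0}, ENNReal.ofReal (logVol d m (nnDist x 0) ^ 2)
      ∂Measure.pi (fun _ : Fin (m + 2) => law f)) atTop (𝓝 0) := by
  have hv : 0 < R ^ d * unitBallVol d := mul_pos (pow_pos hR d) (unitBallVol_pos d)
  have hmeas : ∀ m : ℕ, Measurable fun ω (i : Fin (m + 2)) => X i ω := fun m =>
    measurable_pi_lambda _ fun i => hX i
  have hS : ∀ m : ℕ, MeasurableSet {x : Fin (m + 2) → EuclideanSpace ℝ (Fin d) | R < nnDist x 0} :=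
    fun m => measurableSet_lt measurable_const (measurable_nnDist 0)
  set B := |Real.log (unitBallVol d)| + d * |Real.log R| with hB
  set I := ∫⁻ x, minAvg f x R ^ (-ε) ∂law f with hI
  have hprob : ∀ m : ℕ, Measure.pi (fun _ : Fin (m + 2) => law f) {x | R < nnDist x 0}
      ≤ ENNReal.ofReal ((((m : ℝ) + 1) * (R ^ d * unitBallVol d)) ^ (-ε)) * I := fun m => by
    rw [← ENNReal.ofReal_rpow_of_pos (by positivity)]
    exact measure_lt_nnDist_le hε hε1 hR le_rfl m 0
  have hprob0 : Tendsto (fun m : ℕ => Measure.pi (fun _ : Fin (m + 2) => law f)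
      {x | R < nnDist x 0}) atTop (𝓝 0) := by
    have h1 : Tendsto (fun m : ℕ => (((m : ℝ) + 1) * (R ^ d * unitBallVol d)) ^ (-ε)) atTop
        (𝓝 0) := (tendsto_rpow_neg_atTop hε).comp (Tendsto.atTop_mul_const hv
          (tendsto_atTop_add_const_right _ _ tendsto_natCast_atTop_atTop))
    have h2 := ENNReal.Tendsto.mul_const (ENNReal.tendsto_ofReal h1) (Or.inr hT.ne)
    rw [ENNReal.ofReal_zero, zero_mul] at h2
    exact tendsto_of_tendsto_of_tendsto_of_le_of_le tendsto_const_nhds h2 (fun m => zero_le) hprob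
  have hgm : Measurable fun p : EuclideanSpace ℝ (Fin d) × EuclideanSpace ℝ (Fin d) =>
      ENNReal.ofReal (Real.log (dist p.1 p.2) ^ 2) :=
    ((Real.measurable_log.comp measurable_dist).pow_const 2).ennreal_ofReal
  have hfar : Tendsto (fun m : ℕ => ∫⁻ x in {x | R < nnDist x 0},
      ENNReal.ofReal (Real.log (dist (x 0) (x 1)) ^ 2)
      ∂Measure.pi (fun _ : Fin (m + 2) => law f)) atTop (𝓝 0) := by
    have hfin : ∫⁻ ω, ENNReal.ofReal (Real.log (dist (X 0 ω) (X 1 ω)) ^ 2) ∂P ≠ ∞ := by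
      have h01 := (indepFun_iff_map_prod_eq_prod_map_map (hX 0).aemeasurable
        (hX 1).aemeasurable).1 (hindep.indepFun zero_ne_one)
      rw [hdens, hdens] at h01
      have := lintegral_map (μ := P) hgm ((hX 0).prodMk (hX 1))
      rw [← this, h01, lintegral_prod _ hgm.aemeasurable]
      exact (lintegral_sq_log_dist_lt_top hd hf hδ hK).ne
    -- The product spaces vary with `m`. Pulled back to `Ω`, one fixed integrable function is
    -- integrated over events of vanishing probability.
    refine (tendsto_setLIntegral_zero hfin
      (s := fun m => (fun ω (i : Fin (m + 2)) => X i ω) ⁻¹' {x | R < nnDist x 0}) ?_).congr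
      fun m => ?_
    · refine hprob0.congr fun m => ?_
      rw [← hlaw m, Measure.map_apply (hmeas m) (hS m)]
      rfl
    · have hg : Measurable fun x : Fin (m + 2) → EuclideanSpace ℝ (Fin d) =>
          ENNReal.ofReal (Real.log (dist (x 0) (x 1)) ^ 2) :=
        ((Real.measurable_log.comp ((measurable_pi_apply 0).dist
          (measurable_pi_apply 1))).pow_const 2).ennreal_ofReal
      rw [← hlaw m, setLIntegral_map (hS m) hg (hmeas m)]
      simp only [Fin.val_zero, Fin.val_one]
  have hnear := ENNReal.Tendsto.mul_const
    (ENNReal.tendsto_ofReal (tendsto_sq_log_mul_rpow_neg hε hv B)) (Or.inr hT.ne)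
  rw [ENNReal.ofReal_zero, zero_mul] at hnear
  have hfar' := ENNReal.Tendsto.const_mul hfar
    (Or.inr (ENNReal.ofReal_ne_top (r := 2 * (d : ℝ) ^ 2)))
  rw [mul_zero] at hfar'
  have hsum := hnear.add hfar'
  rw [add_zero] at hsum
  refine tendsto_of_tendsto_of_tendsto_of_le_of_le tendsto_const_nhds hsum (fun m => zero_le)
    fun m => ?_
  calc ∫⁻ x in {x | R < nnDist x 0}, ENNReal.ofReal (logVol d m (nnDist x 0) ^ 2)
        ∂Measure.pi (fun _ : Fin (m + 2) => law f)
      ≤ ∫⁻ x in {x | R < nnDist x 0}, (ENNReal.ofReal (2 * (Real.log ((m : ℝ) + 1) + B) ^ 2)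
          + ENNReal.ofReal (2 * (d : ℝ) ^ 2) * ENNReal.ofReal (Real.log (dist (x 0) (x 1)) ^ 2))
        ∂Measure.pi (fun _ : Fin (m + 2) => law f) := by
        refine setLIntegral_mono' (hS m) fun x hx => ?_
        rw [← ENNReal.ofReal_mul (by positivity), ← ENNReal.ofReal_add (by positivity)
          (by positivity)]
        exact ENNReal.ofReal_le_ofReal
          (sq_logVol_le hR hx (nnDist_le_dist x (by simp)) d m)
    _ = ENNReal.ofReal (2 * (Real.log ((m : ℝ) + 1) + B) ^ 2)
          * Measure.pi (fun _ : Fin (m + 2) => law f) {x | R < nnDist x 0}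
        + ENNReal.ofReal (2 * (d : ℝ) ^ 2) * ∫⁻ x in {x | R < nnDist x 0},
          ENNReal.ofReal (Real.log (dist (x 0) (x 1)) ^ 2)
          ∂Measure.pi (fun _ : Fin (m + 2) => law f) := by
        rw [lintegral_add_left measurable_const, setLIntegral_const,
          lintegral_const_mul' _ _ ENNReal.ofReal_ne_top]
    _ ≤ _ := by
        refine add_le_add_left ?_ _
        rw [ENNReal.ofReal_mul (p := 2 * (Real.log ((m : ℝ) + 1) + B) ^ 2) (by positivity),
          mul_assoc]
        exact mul_le_mul_right (hprob m) _

/-! ### Mean-square consistency -/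

lemma klEstimate_eq_mean_logVol {m : ℕ} {x : Fin (m + 2) → EuclideanSpace ℝ (Fin d)}
    (hx : ∀ i, 0 < nnDist x i) :
    klEstimate x = (∑ i, logVol d m (nnDist x i)) / (m + 2) + Real.eulerMascheroniConstant := by
  have hV := unitBallVol_pos d
  have h1 : ∀ i, logVol d m (nnDist x i)
      = (Real.log ((m : ℝ) + 1) + Real.log (unitBallVol d)) + d * Real.log (nnDist x i) := by
    intro i
    have := hx i
    rw [logVol, Real.log_mul (by positivity) (by positivity), Real.log_mul (by positivity) hV.ne',
      Real.log_pow]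
    ring
  simp_rw [h1]
  rw [Finset.sum_add_distrib, ← Finset.mul_sum, ← Real.log_prod fun i _ => (hx i).ne', klEstimate,
    meanNNDist, Real.log_rpow (Finset.prod_pos fun i _ => hx i)]
  have h2 : (((m + 2 : ℕ) : ℝ)) - 1 = (m : ℝ) + 1 := by
    push_cast
    ring
  rw [h2]
  simp only [Finset.sum_const, Finset.card_univ, Fintype.card_fin, nsmul_eq_mul]
  push_cast
  field_simp
  ring

lemma sq_mean_le {m : ℕ} (D : Fin (m + 2) → ℝ) :
    ((∑ i, D i) / (m + 2)) ^ 2 ≤ (∑ i, D i ^ 2) / (m + 2) := by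
  have h := sq_sum_le_card_mul_sum_sq (s := Finset.univ) (f := D)
  rw [Finset.card_univ, Fintype.card_fin] at h
  push_cast at h
  rw [div_pow, div_le_div_iff₀ (by positivity) (by positivity)]
  nlinarith [mul_le_mul_of_nonneg_right h (by positivity : (0 : ℝ) ≤ (m : ℝ) + 2)]

/-- Convexity of the square, then exchangeability, reduce the average to sample point `0`. -/
lemma lintegral_sq_mean_sub_clamp_le {f : EuclideanSpace ℝ (Fin d) → ℝ}
    [IsProbabilityMeasure (law f)] (m : ℕ) (A : ℝ) :
    ∫⁻ x, ENNReal.ofReal (((∑ i, (logVol d m (nnDist x i) - clamp A (logVol d m (nnDist x i))))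
        / (m + 2)) ^ 2) ∂Measure.pi (fun _ : Fin (m + 2) => law f)
      ≤ ∫⁻ x, ENNReal.ofReal ((logVol d m (nnDist x 0) - clamp A (logVol d m (nnDist x 0))) ^ 2)
        ∂Measure.pi (fun _ : Fin (m + 2) => law f) := by
  have hφ : Measurable fun r : ℝ => ENNReal.ofReal ((logVol d m r - clamp A (logVol d m r)) ^ 2) :=
    (((measurable_logVol d m).sub ((measurable_clamp A).comp
      (measurable_logVol d m))).pow_const 2).ennreal_ofReal
  have hφi : ∀ i : Fin (m + 2), Measurable fun x : Fin (m + 2) → EuclideanSpace ℝ (Fin d) =>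
      ENNReal.ofReal ((logVol d m (nnDist x i) - clamp A (logVol d m (nnDist x i))) ^ 2) :=
    fun i => hφ.comp (measurable_nnDist i)
  have h2 : (0 : ℝ) < (m : ℝ) + 2 := by positivity
  calc _ ≤ ∫⁻ x, ENNReal.ofReal (1 / (m + 2)) * ∑ i, ENNReal.ofReal
          ((logVol d m (nnDist x i) - clamp A (logVol d m (nnDist x i))) ^ 2)
          ∂Measure.pi (fun _ : Fin (m + 2) => law f) := by
        refine lintegral_mono fun x => ?_
        rw [← ENNReal.ofReal_sum_of_nonneg fun i _ => sq_nonneg _,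
          ← ENNReal.ofReal_mul (by positivity)]
        refine ENNReal.ofReal_le_ofReal ((sq_mean_le _).trans_eq ?_)
        ring
    _ = ENNReal.ofReal (1 / (m + 2)) * ((m + 2 : ℕ) * ∫⁻ x, ENNReal.ofReal
          ((logVol d m (nnDist x 0) - clamp A (logVol d m (nnDist x 0))) ^ 2)
          ∂Measure.pi (fun _ : Fin (m + 2) => law f)) := by
        rw [lintegral_const_mul' _ _ ENNReal.ofReal_ne_top,
          lintegral_finsetSum _ fun i _ => hφi i,
          Finset.sum_congr rfl fun i _ => lintegral_comp_nnDist_eq (law f) i 0 hφ]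
        simp
    _ = _ := by
        rw [← mul_assoc, ← ENNReal.ofReal_natCast, ← ENNReal.ofReal_mul (by positivity)]
        push_cast
        rw [one_div_mul_cancel h2.ne', ENNReal.ofReal_one, one_mul]

lemma lintegral_sq_sub_clamp_le (hd : 0 < d) {f : EuclideanSpace ℝ (Fin d) → ℝ}
    [IsProbabilityMeasure (law f)] {ε R : ℝ} (hε : 0 < ε) (hε1 : ε ≤ 1) (hR : 0 < R)
    (hQ : ∫⁻ x, maxAvg f x R ^ ε ∂law f < ∞) (hT : ∫⁻ x, minAvg f x R ^ (-ε) ∂law f < ∞) {m : ℕ}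
    (hm : 1 ≤ ((m : ℝ) + 1) * (R ^ d * unitBallVol d)) {A : ℝ} (hA : 0 ≤ A) :
    ∫⁻ x, ENNReal.ofReal ((logVol d m (nnDist x 0) - clamp A (logVol d m (nnDist x 0))) ^ 2)
        ∂Measure.pi (fun _ : Fin (m + 2) => law f)
      ≤ (∫⁻ x, minAvg f x R ^ (-ε) ∂law f + ∫⁻ x, maxAvg f x R ^ ε ∂law f)
          * ENNReal.ofReal (Real.exp (-(ε * A))) * expTailConst ε
        + ∫⁻ x in {x | R < nnDist x 0}, ENNReal.ofReal (logVol d m (nnDist x 0) ^ 2)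
          ∂Measure.pi (fun _ : Fin (m + 2) => law f) := by
  have hS : MeasurableSet {x : Fin (m + 2) → EuclideanSpace ℝ (Fin d) | nnDist x 0 ≤ R} :=
    measurableSet_le (measurable_nnDist 0) measurable_const
  have hcompl : {x : Fin (m + 2) → EuclideanSpace ℝ (Fin d) | nnDist x 0 ≤ R}ᶜ
      = {x | R < nnDist x 0} := by ext; simp
  have hsq : ∀ w : ℝ, (w - clamp A w) ^ 2 = max (|w| - A) 0 ^ 2 := fun w => by
    rw [← abs_sub_clamp hA, sq_abs]
  rw [← lintegral_add_compl _ hS, hcompl]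
  simp_rw [hsq]
  refine add_le_add ?_ (lintegral_mono fun x => ENNReal.ofReal_le_ofReal ?_)
  · exact lintegral_sq_excess_le (Y := fun x => |logVol d m (nnDist x 0)|)
      (((measurable_logVol d m).comp (measurable_nnDist 0)).abs)
      (fun s hs => measure_lt_abs_logVol_le hd hε hε1 hR hm 0 hs) hA
      (ENNReal.add_lt_top.2 ⟨hT, hQ⟩).ne
  · rw [← sq_abs (logVol d m (nnDist x 0))]
    refine pow_le_pow_left₀ (le_max_right _ _) (max_le (by linarith) (abs_nonneg _)) 2

/-- The iterated limit: first `m → ∞` at a fixed truncation level `n`, then `n → ∞`. -/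
lemma tendsto_zero_of_le_add {L b : ℕ → ℝ≥0∞} {u : ℕ → ℕ → ℝ≥0∞}
    (h : ∀ n, ∀ᶠ m in atTop, L m ≤ b n + u n m) (hb : Tendsto b atTop (𝓝 0))
    (hu : ∀ n, Tendsto (u n) atTop (𝓝 0)) : Tendsto L atTop (𝓝 0) := by
  rw [ENNReal.tendsto_nhds_zero] at hb ⊢
  intro ε hε
  obtain ⟨n, hn⟩ := (hb (ε / 2) (ENNReal.half_pos hε.ne')).exists
  filter_upwards [h n, ENNReal.tendsto_nhds_zero.1 (hu n) (ε / 2) (ENNReal.half_pos hε.ne')]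
    with m h1 h2
  exact h1.trans ((add_le_add hn h2).trans_eq (ENNReal.add_halves ε))

lemma ofReal_sq_add_le (a b c : ℝ) : ENNReal.ofReal ((a + b + c) ^ 2)
    ≤ 3 * ENNReal.ofReal (a ^ 2) + 3 * ENNReal.ofReal (b ^ 2) + 3 * ENNReal.ofReal (c ^ 2) := by
  have h3 : (3 : ℝ≥0∞) = ENNReal.ofReal 3 := by simp
  rw [h3, ← ENNReal.ofReal_mul (by norm_num), ← ENNReal.ofReal_mul (by norm_num),
    ← ENNReal.ofReal_mul (by norm_num), ← ENNReal.ofReal_add (by positivity) (by positivity),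
    ← ENNReal.ofReal_add (by positivity) (by positivity)]
  refine ENNReal.ofReal_le_ofReal ?_
  nlinarith [sq_nonneg (a - b), sq_nonneg (b - c), sq_nonneg (a - c)]

lemma tendsto_lintegral_sq_klEstimate_sub_entropy {Ω : Type*} [MeasurableSpace Ω] {P : Measure Ω}
    [IsProbabilityMeasure P] (hd : 0 < d) {f : EuclideanSpace ℝ (Fin d) → ℝ}
    (hf : AEMeasurable f volume) (hf0 : ∀ x, 0 ≤ f x) [IsProbabilityMeasure (law f)]
    {X : ℕ → Ω → EuclideanSpace ℝ (Fin d)} (hX : ∀ i, Measurable (X i))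
    (hindep : iIndepFun X P) (hdens : ∀ i, P.map (X i) = law f) {ε δ R : ℝ} (hδ : 0 < δ)
    (hK : K₂ f δ < ∞) (hε : 0 < ε) (hε1 : ε ≤ 1) (hR : 0 < R)
    (hQ : ∫⁻ x, maxAvg f x R ^ ε ∂law f < ∞) (hT : ∫⁻ x, minAvg f x R ^ (-ε) ∂law f < ∞) :
    Tendsto (fun m : ℕ => ∫⁻ ω, ENNReal.ofReal
      ((klEstimate (fun i : Fin (m + 2) => X i ω) - entropy f) ^ 2) ∂P) atTop (𝓝 0) := by
  have hlaw : ∀ m : ℕ, P.map (fun ω (i : Fin (m + 2)) => X i ω)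
      = Measure.pi fun _ : Fin (m + 2) => law f := fun m => by
    have h := (iIndepFun_iff_map_fun_eq_pi_map (f := fun i : Fin (m + 2) => X i)
      fun i => (hX i).aemeasurable).1 (hindep.precomp Fin.val_injective)
    simpa only [hdens] using h
  have hlog := integrable_log_law hd hf hε hR hQ hT
  have hfar := tendsto_lintegral_sq_logVol_far hd hf hX hindep hdens hlaw hδ hK hε hε1 hR hT
  set C := ∫⁻ x, minAvg f x R ^ (-ε) ∂law f + ∫⁻ x, maxAvg f x R ^ ε ∂law f with hC
  have hCfin : C ≠ ∞ := (ENNReal.add_lt_top.2 ⟨hT, hQ⟩).ne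
  set γ := Real.eulerMascheroniConstant with hγ
  have hv : 0 < R ^ d * unitBallVol d := mul_pos (pow_pos hR d) (unitBallVol_pos d)
  have hlarge : ∀ᶠ m : ℕ in atTop, 1 ≤ ((m : ℝ) + 1) * (R ^ d * unitBallVol d) :=
    (Tendsto.atTop_mul_const hv
      (tendsto_atTop_add_const_right _ _ tendsto_natCast_atTop_atTop)).eventually_ge_atTop 1
  -- The error splits into truncation, fluctuation of the clamped mean, and bias. `b` holds what
  -- does not depend on `m`: the exponential tail beyond level `n` and the bias.
  refine tendsto_zero_of_le_add
    (b := fun n : ℕ => 3 * (C * ENNReal.ofReal (Real.exp (-(ε * n))) * expTailConst ε)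
      + 3 * ENNReal.ofReal ((truncMean f n + γ - entropy f) ^ 2))
    (u := fun n m => 3 * (∫⁻ x in {x | R < nnDist x 0},
        ENNReal.ofReal (logVol d m (nnDist x 0) ^ 2) ∂Measure.pi (fun _ : Fin (m + 2) => law f))
      + 3 * ∫⁻ x, ENNReal.ofReal
        (((∑ i, clamp n (logVol d m (nnDist x i))) / (m + 2) - truncMean f n) ^ 2)
        ∂Measure.pi (fun _ : Fin (m + 2) => law f)) (fun n => ?_) ?_ fun n => ?_
  · filter_upwards [hlarge] with m hm
    have hkl : Measurable fun x : Fin (m + 2) → EuclideanSpace ℝ (Fin d) =>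
        ENNReal.ofReal ((klEstimate x - entropy f) ^ 2) :=
      ((measurable_klEstimate.sub_const _).pow_const 2).ennreal_ofReal
    have hW : ∀ i : Fin (m + 2), Measurable fun x : Fin (m + 2) → EuclideanSpace ℝ (Fin d) =>
        logVol d m (nnDist x i) := fun i => (measurable_logVol d m).comp (measurable_nnDist i)
    have hcW : ∀ i : Fin (m + 2), Measurable fun x : Fin (m + 2) → EuclideanSpace ℝ (Fin d) =>
        clamp n (logVol d m (nnDist x i)) := fun i => (measurable_clamp n).comp (hW i)
    have hm1 : Measurable fun x : Fin (m + 2) → EuclideanSpace ℝ (Fin d) => ENNReal.ofReal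
        (((∑ i, (logVol d m (nnDist x i) - clamp n (logVol d m (nnDist x i)))) / (m + 2)) ^ 2) :=
      (((Finset.measurable_fun_sum _ fun i _ =>
        (hW i).sub (hcW i)).div_const _).pow_const 2).ennreal_ofReal
    have hm2 : Measurable fun x : Fin (m + 2) → EuclideanSpace ℝ (Fin d) => ENNReal.ofReal
        (((∑ i, clamp n (logVol d m (nnDist x i))) / (m + 2) - truncMean f n) ^ 2) :=
      ((((Finset.measurable_fun_sum _ fun i _ =>
        hcW i).div_const _).sub_const _).pow_const 2).ennreal_ofReal
    have htail := (lintegral_sq_mean_sub_clamp_le (f := f) m n).trans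
      (lintegral_sq_sub_clamp_le hd hε hε1 hR hQ hT hm n.cast_nonneg)
    rw [← hC] at htail
    have hmap := lintegral_map (μ := P) hkl
      (measurable_pi_lambda (fun ω (i : Fin (m + 2)) => X i ω) fun i => hX i)
    rw [← hmap, hlaw m]
    calc ∫⁻ x, ENNReal.ofReal ((klEstimate x - entropy f) ^ 2)
          ∂Measure.pi (fun _ : Fin (m + 2) => law f)
        ≤ ∫⁻ x, (3 * ENNReal.ofReal (((∑ i, (logVol d m (nnDist x i)
              - clamp n (logVol d m (nnDist x i)))) / (m + 2)) ^ 2)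
            + 3 * ENNReal.ofReal
              (((∑ i, clamp n (logVol d m (nnDist x i))) / (m + 2) - truncMean f n) ^ 2)
            + 3 * ENNReal.ofReal ((truncMean f n + γ - entropy f) ^ 2))
          ∂Measure.pi (fun _ : Fin (m + 2) => law f) := by
          refine lintegral_mono_ae ?_
          filter_upwards [ae_nnDist_pos hd (f := f) m] with x hx
          refine le_trans (ENNReal.ofReal_le_ofReal (le_of_eq ?_)) (ofReal_sq_add_le _ _ _)
          rw [klEstimate_eq_mean_logVol hx, Finset.sum_sub_distrib]
          ring
      _ = 3 * (∫⁻ x, ENNReal.ofReal (((∑ i, (logVol d m (nnDist x i)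
              - clamp n (logVol d m (nnDist x i)))) / (m + 2)) ^ 2)
              ∂Measure.pi (fun _ : Fin (m + 2) => law f))
          + 3 * (∫⁻ x, ENNReal.ofReal
              (((∑ i, clamp n (logVol d m (nnDist x i))) / (m + 2) - truncMean f n) ^ 2)
              ∂Measure.pi (fun _ : Fin (m + 2) => law f))
          + 3 * ENNReal.ofReal ((truncMean f n + γ - entropy f) ^ 2) := by
          rw [lintegral_add_right _ measurable_const, lintegral_add_left (hm1.const_mul _),
            lintegral_const_mul _ hm1, lintegral_const_mul _ hm2, lintegral_const, measure_univ,
            mul_one]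
      _ ≤ 3 * (C * ENNReal.ofReal (Real.exp (-(ε * n))) * expTailConst ε
            + ∫⁻ x in {x | R < nnDist x 0}, ENNReal.ofReal (logVol d m (nnDist x 0) ^ 2)
              ∂Measure.pi (fun _ : Fin (m + 2) => law f))
          + 3 * (∫⁻ x, ENNReal.ofReal
              (((∑ i, clamp n (logVol d m (nnDist x i))) / (m + 2) - truncMean f n) ^ 2)
              ∂Measure.pi (fun _ : Fin (m + 2) => law f))
          + 3 * ENNReal.ofReal ((truncMean f n + γ - entropy f) ^ 2) :=
          add_le_add_left (add_le_add_left (mul_le_mul_right htail _) _) _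
      _ = _ := by ring
  · have h1 : Tendsto (fun n : ℕ => ENNReal.ofReal (Real.exp (-(ε * n)))) atTop (𝓝 0) := by
      have := ENNReal.tendsto_ofReal (Real.tendsto_exp_neg_atTop_nhds_zero.comp
        (tendsto_natCast_atTop_atTop.const_mul_atTop hε))
      rwa [ENNReal.ofReal_zero] at this
    have h2 := ENNReal.Tendsto.const_mul (a := 3) (ENNReal.Tendsto.mul_const
      (ENNReal.Tendsto.const_mul h1 (Or.inr hCfin))
      (Or.inr (expTailConst_ne_top hε))) (Or.inr (by simp))
    have h3 : Tendsto (fun n : ℕ => (truncMean f n + γ - entropy f) ^ 2) atTop (𝓝 0) := by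
      have := (((tendsto_truncMean hf hf0 hlog).add_const γ).sub_const (entropy f)).pow 2
      simpa [hγ] using this
    have h4 := ENNReal.Tendsto.const_mul (a := 3) (ENNReal.tendsto_ofReal h3) (Or.inr (by simp))
    have h5 := h2.add h4
    simpa using h5
  · have h1 := ENNReal.Tendsto.const_mul (a := 3) hfar (Or.inr (by simp))
    have h2 := ENNReal.Tendsto.const_mul (a := 3)
      (tendsto_sq_mean_clamp_sub hd hf hf0 (n.cast_nonneg (α := ℝ))) (Or.inr (by simp))
    have h3 := h1.add h2
    simpa using h3

end KozachenkoLeonenko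

end

theorem theorem2 {d : ℕ} (hd : 0 < d)
    {Ω : Type*} [MeasurableSpace Ω] (P : Measure Ω) [IsProbabilityMeasure P]
    (f : EuclideanSpace ℝ (Fin d) → ℝ) (hf : AEMeasurable f volume) (hf0 : ∀ x, 0 ≤ f x)
    (X : ℕ → Ω → EuclideanSpace ℝ (Fin d)) (hX : ∀ i, Measurable (X i))
    (hindep : iIndepFun X P)
    (hdens : ∀ i, P.map (X i) = volume.withDensity (fun x => ENNReal.ofReal (f x)))
    (ε₀ ε₁ ε₂ R₁ R₂ : ℝ) (hε₀ : 0 < ε₀) (hε₁ : 0 < ε₁) (hε₂ : 0 < ε₂)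
    (hR₁ : 0 < R₁) (hR₂ : 0 < R₂)
    (hK : KozachenkoLeonenko.K₂ f ε₀ < ∞)
    (hQ : KozachenkoLeonenko.Q f ε₁ R₁ < ∞)
    (hT : KozachenkoLeonenko.T f ε₂ R₂ < ∞) :
    Integrable (fun x => f x * Real.log (f x)) volume ∧
    Tendsto (fun N : ℕ => ∫⁻ ω, ENNReal.ofReal
        ((KozachenkoLeonenko.klEstimate (fun i : Fin N => X i ω)
          - KozachenkoLeonenko.entropy f) ^ 2) ∂P) atTop (𝓝 0) := by
  have hprob : IsProbabilityMeasure (KozachenkoLeonenko.law f) := by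
    rw [KozachenkoLeonenko.law, ← hdens 0]
    exact Measure.isProbabilityMeasure_map (hX 0).aemeasurable
  -- The tail bounds need one exponent for both functionals, at most `1`.
  set ε := min 1 (min ε₁ ε₂)
  set R := min R₁ R₂
  have hε : 0 < ε := lt_min one_pos (lt_min hε₁ hε₂)
  have hR : 0 < R := lt_min hR₁ hR₂
  have hQ' := KozachenkoLeonenko.lintegral_maxAvg_lt_top hf hQ hε.le
    ((min_le_right _ _).trans (min_le_left _ _)) (min_le_left _ _ : R ≤ R₁)
  have hT' := KozachenkoLeonenko.lintegral_minAvg_lt_top hf hT hε.le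
    ((min_le_right _ _).trans (min_le_right _ _)) (min_le_right _ _ : R ≤ R₂)
  refine ⟨(KozachenkoLeonenko.integrable_law_iff hf hf0).1
    (KozachenkoLeonenko.integrable_log_law hd hf hε hR hQ' hT'), ?_⟩
  -- The shift `N = m + 2` discards the sample sizes without a nearest neighbour.
  exact (tendsto_add_atTop_iff_nat 2).1
    (KozachenkoLeonenko.tendsto_lintegral_sq_klEstimate_sub_entropy hd hf hf0 hX hindep hdens hε₀ hK
      hε (min_le_left _ _) hR hQ' hT')
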